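/- Let $n\ge 2$ and $d\ge 1$ be integers. A pure $n$-qudit state $|\psi\rangle\in(\mathbb{C}^d)^{\otimes n}$ (a unit vector, with projector $\psi=|\psi\rangle\langle\psi|$) is multipartite product if $|\psi\rangle=\bigotimes_{i=1}^n|\phi_i\rangle$ for some pure states $|\phi_i\rangle\in\mathbb{C}^d$; let $\mathcal{M}_n$ be the set of these states. For $\varepsilon>0$ call $|\psi\rangle$ $\varepsilon$-far from $\mathcal{M}_n$ if $\tfrac12\|\psi-\varphi\|_1\ge\varepsilon$ for all $|\varphi\rangle\in\mathcal{M}_n$. An $\varepsilon$-tester for multipartite productness on $T$ copies is a two-outcome POVM $\{M,\mathbb{I}-M\}$ on $((\mathbb{C}^d)^{\otimes n})^{\otimes T}$ such that $\mathrm{tr}(M\psi^{\otimes T})\ge 2/3$ for every $|\psi\rangle\in\mathcal{M}_n$ and $\mathrm{tr}(M\psi^{\otimes T})\le 1/3$ for every pure state $|\psi\rangle$ that is $\varepsilon$-far from $\mathcal{M}_n$. It uses (possibly adaptive) single-copy measurements if it is carried out as follows: in rounds $t=1,\dots,T$ the $t$-th copy alone is measured with a POVM on $(\mathbb{C}^d)^{\otimes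 n}$ with countably many outcomes, which may depend on the outcomes of all earlier rounds, and after the last round the algorithm accepts with a probability that depends on the whole string of outcomes. Theorem. Every $\varepsilon$-tester for multipartite productness that uses (possibly adaptive) single-copy measurements needs $T=\Omega(\sqrt{d/n})$ copies, for every fixed $0<\varepsilon<1$. Precisely: there is an absolute constant $c>0$ such that for every $\varepsilon\in(0,1)$ there is $d_0=d_0(\varepsilon)$ such that for all $d\ge d_0$, all $n\ge 2$ and all $T\ge 0$, if there is an $\varepsilon$-tester for multipartite productness on $T$ copies that uses (possibly adaptive) single-copy measurements, then $T\ge c\sqrt{d/n}$. -/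

import Mathlib

open scoped Matrix BigOperators ComplexOrder

/-- The computational basis of `(ℂ^d)^{⊗ n}`: strings of `n` symbols from an alphabet of size `d`.
Vectors of `(ℂ^d)^{⊗ n}` are given by their coordinates in this basis. -/
abbrev QuditIdx (n d : ℕ) : Type := Fin n → Fin d

/-- The Hilbert space `(ℂ^d)^{⊗ n}` of `n` qudits. -/
abbrev QuditSpace (n d : ℕ) : Type := EuclideanSpace ℂ (QuditIdx n d)

/-- The rank-one operator `|ψ⟩⟨ψ|`. -/
noncomputable def ketBra {ι : Type} (ψ : EuclideanSpace ℂ ι) : Matrix ι ι ℂ :=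
  Matrix.of fun x y => ψ x * star (ψ y)

/-- The set of (unit vectors of) pure states of `n` qudits. -/
def pureStates (n d : ℕ) : Set (QuditSpace n d) := {ψ | ‖ψ‖ = 1}

/-- The multipartite product states: `ψ = φ₁ ⊗ ⋯ ⊗ φₙ` with pure states `φᵢ ∈ ℂ^d`. -/
def multipartiteProduct (n d : ℕ) : Set (QuditSpace n d) :=
  {ψ | ∃ φ : Fin n → EuclideanSpace ℂ (Fin d),
    (∀ i, ‖φ i‖ = 1) ∧ ∀ x : QuditIdx n d, ψ x = ∏ i, φ i (x i)}

/-- The trace norm `‖X‖₁ = tr √(Xᴴ X)`, the sum of the square roots of the eigenvalues (with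
multiplicity) of `Xᴴ X`. -/
noncomputable def traceNorm {ι : Type} [Fintype ι] [DecidableEq ι] (X : Matrix ι ι ℂ) : ℝ :=
  ∑ i, √((Matrix.isHermitian_conjTranspose_mul_self X).eigenvalues i)

/-- The trace distance `½ ‖ρ - σ‖₁`. -/
noncomputable def traceDist {ι : Type} [Fintype ι] [DecidableEq ι] (ρ σ : Matrix ι ι ℂ) : ℝ :=
  traceNorm (ρ - σ) / 2

/-- `ψ` is `ε`-far (in trace distance) from every element of the set `P` of pure states. -/
def IsFar {ι : Type} [Fintype ι] [DecidableEq ι] (ε : ℝ) (P : Set (EuclideanSpace ℂ ι))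
    (ψ : EuclideanSpace ℂ ι) : Prop :=
  ∀ φ ∈ P, ε ≤ traceDist (ketBra φ) (ketBra ψ)

/-- The tensor product `X₁ ⊗ ⋯ ⊗ X_T` of operators on a space with basis `ι`, as an operator on the
`T`-fold tensor power, whose basis is `Fin T → ι`. -/
def tensorOp {ι : Type} {T : ℕ} (X : Fin T → Matrix ι ι ℂ) :
    Matrix (Fin T → ι) (Fin T → ι) ℂ :=
  Matrix.of fun x y => ∏ t, X t (x t) (y t)

/-- The state `(|ψ⟩⟨ψ|)^{⊗ T}` of `T` copies of `ψ`. -/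
noncomputable def copies {ι : Type} (T : ℕ) (ψ : EuclideanSpace ℂ ι) :
    Matrix (Fin T → ι) (Fin T → ι) ℂ :=
  tensorOp fun _ : Fin T => ketBra ψ

/-- `{M, 1 - M}` is an `ε`-tester on `T` copies for the property `P` of `n`-qudit pure states; the
outcome `M` means "accept". -/
structure IsTester {n d T : ℕ} (ε : ℝ) (P : Set (QuditSpace n d))
    (M : Matrix (Fin T → QuditIdx n d) (Fin T → QuditIdx n d) ℂ) : Prop where
  posSemidef : M.PosSemidef
  posSemidef_compl : (1 - M).PosSemidef
  completeness : ∀ ψ ∈ pureStates n d, ψ ∈ P → 2 / 3 ≤ ((M * copies T ψ).trace).re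
  soundness : ∀ ψ ∈ pureStates n d, IsFar ε P ψ → ((M * copies T ψ).trace).re ≤ 1 / 3

/-- A positive operator-valued measure with countably many outcomes, labelled by `ℕ` (a POVM with
finitely many outcomes is padded by zero operators). -/
structure POVM (ι : Type) [Fintype ι] [DecidableEq ι] where
  effect : ℕ → Matrix ι ι ℂ
  posSemidef : ∀ k, (effect k).PosSemidef
  complete : HasSum effect 1

/-- An adaptive single-copy measurement strategy for `T` copies: in round `t` the `t`-th copy alone
is measured with a POVM that may depend on the outcomes of all earlier rounds. -/
structure AdaptiveStrategy (ι : Type) [Fintype ι] [DecidableEq ι] (T : ℕ) where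
  povm : (t : Fin T) → (Fin t → ℕ) → POVM ι

/-- The operator `E₁ ⊗ ⋯ ⊗ E_T` on `T` copies that belongs to the string of outcomes
`ℓ = (ℓ₁, …, ℓ_T)`: the probability of `ℓ` on copies of `ρ` is `∏ₜ tr (ρ Eₜ)`, where `Eₜ` is the
element for `ℓₜ` of the POVM chosen after `ℓ₁, …, ℓₜ₋₁`. -/
def AdaptiveStrategy.outcomeOp {ι : Type} [Fintype ι] [DecidableEq ι] {T : ℕ}
    (A : AdaptiveStrategy ι T) (ℓ : Fin T → ℕ) : Matrix (Fin T → ι) (Fin T → ι) ℂ :=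
  tensorOp fun t : Fin T =>
    (A.povm t fun s => ℓ (Fin.castLE t.isLt.le s)).effect (ℓ t)

/-- The two-outcome measurement `{M, 1 - M}` on `T` copies is carried out by an algorithm that uses
adaptive single-copy measurements: having seen the string `ℓ` of all outcomes, the algorithm accepts
with probability `f ℓ`. (Randomness within the rounds can be made part of the outcomes.) -/
def IsAdaptiveSingleCopy {ι : Type} [Fintype ι] [DecidableEq ι] {T : ℕ}
    (M : Matrix (Fin T → ι) (Fin T → ι) ℂ) : Prop :=
  ∃ (A : AdaptiveStrategy ι T) (f : (Fin T → ℕ) → ℝ),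
    (∀ ℓ, 0 ≤ f ℓ ∧ f ℓ ≤ 1) ∧ HasSum (fun ℓ => (f ℓ : ℂ) • A.outcomeOp ℓ) M

/-!
An adaptive single-copy algorithm is compared on three inputs: a random product state, a random
state of all `n` qudits, and the maximally mixed state. Up to a factor close to `1`, every outcome
string is at least as likely on the random states as on the maximally mixed state. The algorithm
rejects product states with probability at most `1/3`, so it rejects the maximally mixed state with
probability not much more than `1/3`. A random state is far from product with high probability, so
the maximally mixed state is also accepted with probability not much more than `1/3`. The two
probabilities sum to `1`, a contradiction when `T` is small.

The random states are made from vectors `g` of independent standard complex Gaussian variables,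
without normalization: acceptance is a homogeneous polynomial in the state and its conjugate, so the
tester's promise on unit vectors carries over with a power of the norm as a factor. Under
`⟨p, q⟩ = 𝔼 [conj (p g) * q g]` multiplication by a variable is adjoint to differentiation
(`IsComplexGaussian.fischer_X_mul_left`), and everything is derived from this:

* A multilinear form `p_v` with coefficients `v` in disjoint blocks of variables satisfies
  `‖p_v q‖² ≥ ‖v‖² ‖q‖²` for every polynomial `q` (`IsComplexGaussian.multilinear_mul_le`). With
  positive operators written as `Bᴴ * B`, repeated use gives
  `𝔼 ∏ₜ ⟨ψ|Eₜ|ψ⟩ ≥ ∏ₜ tr Eₜ`, where `ψ = g` or `ψ = g₁ ⊗ ⋯ ⊗ gₙ`. The right-hand side is,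
  up to normalization, the probability for the maximally mixed state
  (`IsComplexGaussian.trace_le_integral`).
* By Euler's identity a factor `‖g‖²` in an expectation contributes the dimension plus the degree
  (`IsComplexGaussian.integral_sqNorm_pow_mul`). So `𝔼 ‖g‖^(2T) = D (D + 1) ⋯ (D + T - 1)`, which
  is at most `D ^ T * exp (T² / D)`. For `n` factors of dimension `d` the error is `exp (n T² / d)`,
  whence the bound `√(d / n)`.

A state that is not `ε`-far from product has overlap more than `1 - ε²` with a product state, and
then its reduced state on the first qudit has purity at least `(1 - ε²)²`
(`le_firstPurity_of_not_isFar`), whereas the purity of a random state is of order `1 / d` on average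
(`IsComplexGaussian.integral_firstPurity`).
-/

/-! ### Complex Gaussian vectors -/

open MeasureTheory in
/-- The exponential law on the half-line. -/
noncomputable def radialMeasure : Measure ℝ :=
  (volume.restrict (Set.Ioi 0)).withDensity fun s => ENNReal.ofReal (Real.exp (-s))

open MeasureTheory in
/-- The law of the squared modulus and the phase of a standard complex Gaussian variable. -/
noncomputable def polarMeasure : Measure (ℝ × UnitAddCircle) :=
  radialMeasure.prod AddCircle.haarAddCircle

/-- A standard complex Gaussian variable, as a function of its squared modulus and its phase. -/
noncomputable def polarGaussian (p : ℝ × UnitAddCircle) : ℂ := (√p.1 : ℂ) * fourier 1 p.2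

open MeasureTheory in
theorem integrable_radialMeasure_sqrt_pow (m : ℕ) :
    Integrable (fun s : ℝ => (√s : ℂ) ^ m) radialMeasure := by
  unfold radialMeasure
  rw [integrable_withDensity_iff_integrable_smul' (by fun_prop) (by simp)]
  have h := (Real.GammaIntegral_convergent (s := (m : ℝ) / 2 + 1) (by positivity)).ofReal (𝕜 := ℂ)
  refine (integrable_congr ?_).2 h
  filter_upwards [ae_restrict_mem measurableSet_Ioi] with s hs
  have hs : 0 < s := hs
  rw [ENNReal.toReal_ofReal (Real.exp_pos _).le, Real.sqrt_eq_rpow, ← Complex.ofReal_pow,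
    ← Real.rpow_natCast, ← Real.rpow_mul hs.le]
  have hm : (1 / 2 : ℝ) * m = m / 2 + 1 - 1 := by ring
  rw [hm, Complex.real_smul, ← Complex.ofReal_mul]
  rfl

open MeasureTheory in
theorem integral_radialMeasure_pow (a : ℕ) :
    ∫ s, (√s : ℂ) ^ (2 * a) ∂radialMeasure = (a.factorial : ℂ) := by
  unfold radialMeasure
  rw [integral_withDensity_eq_integral_toReal_smul (by fun_prop) (by simp)]
  rw [← Complex.ofReal_natCast, ← Real.Gamma_nat_eq_factorial, Real.Gamma_eq_integral (by positivity),
    ← integral_complex_ofReal]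
  refine setIntegral_congr_fun measurableSet_Ioi fun s hs => ?_
  have hs : 0 < s := hs
  simp only [ENNReal.toReal_ofReal (Real.exp_pos _).le]
  rw [← Complex.ofReal_pow, pow_mul, Real.sq_sqrt hs.le]
  simp [Real.rpow_natCast]

open MeasureTheory in
instance isProbabilityMeasure_radialMeasure : IsProbabilityMeasure radialMeasure := by
  have h := integral_radialMeasure_pow 0
  have h1 : radialMeasure.real Set.univ = 1 := by
    simp only [mul_zero, pow_zero, integral_const, Nat.factorial_zero, Nat.cast_one] at h
    simpa using congrArg Complex.re h
  exact ⟨by rwa [Measure.real, ENNReal.toReal_eq_one_iff] at h1⟩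

open MeasureTheory in
instance isProbabilityMeasure_polarMeasure : IsProbabilityMeasure polarMeasure := by
  unfold polarMeasure; infer_instance

theorem conj_polarGaussian_pow_mul_pow (a b : ℕ) (p : ℝ × UnitAddCircle) :
    star (polarGaussian p ^ a) * polarGaussian p ^ b =
      (√p.1 : ℂ) ^ (a + b) * fourier ((b : ℤ) - a) p.2 := by
  have h (k : ℕ) : (fourier 1 p.2 : ℂ) ^ k = fourier k p.2 := by
    induction k with
    | zero => simp
    | succ k ih => rw [pow_succ, ih, Nat.cast_succ, fourier_add]
  simp only [polarGaussian, mul_pow, h, star_mul']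
  have : star (fourier (a : ℤ) p.2 : ℂ) = fourier (-(a : ℤ)) p.2 := by
    rw [fourier_neg]; rfl
  rw [this, sub_eq_add_neg, fourier_add]
  simp
  ring

open MeasureTheory in
theorem integrable_polarGaussian (a b : ℕ) :
    Integrable (fun p => star (polarGaussian p ^ a) * polarGaussian p ^ b) polarMeasure := by
  simp only [conj_polarGaussian_pow_mul_pow]
  refine (integrable_radialMeasure_sqrt_pow (a + b)).mul_prod
    (g := fun x : UnitAddCircle => fourier ((b : ℤ) - a) x) ?_
  exact (ContinuousMap.continuous _).integrable_of_hasCompactSupport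
    (HasCompactSupport.of_compactSpace _)

open MeasureTheory in
theorem integral_polarGaussian (a b : ℕ) :
    ∫ p, star (polarGaussian p ^ a) * polarGaussian p ^ b ∂polarMeasure =
      if a = b then (a.factorial : ℂ) else 0 := by
  simp only [conj_polarGaussian_pow_mul_pow]
  unfold polarMeasure
  rw [integral_prod_mul (fun s : ℝ => (√s : ℂ) ^ (a + b))
    (fun x : UnitAddCircle => (fourier ((b : ℤ) - a) x : ℂ))]
  split_ifs with h
  · subst h
    rw [← two_mul, integral_radialMeasure_pow]
    simp
  · have h2 := congrFun (fourierCoeff_fourier (T := 1) ((b : ℤ) - a)) 0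
    rw [Pi.single_eq_of_ne (by omega)] at h2
    simp only [fourierCoeff, neg_zero, fourier_zero, one_smul] at h2
    rw [h2, mul_zero]

open MeasureTheory in
/-- `g` is a vector of independent standard complex Gaussian variables, as far as polynomials in
`g` and its conjugate can tell: the moments `𝔼 [conj (g ^ α) * g ^ β]` are `α!` for `α = β` and
vanish otherwise. -/
structure IsComplexGaussian {Ω σ : Type*} [MeasurableSpace Ω] [Fintype σ] (μ : Measure Ω)
    (g : Ω → σ → ℂ) : Prop where
  integrable : ∀ α β : σ → ℕ,
    Integrable (fun ω => star (∏ i, g ω i ^ α i) * ∏ i, g ω i ^ β i) μ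
  moment : ∀ α β : σ → ℕ, ∫ ω, star (∏ i, g ω i ^ α i) * ∏ i, g ω i ^ β i ∂μ =
    if α = β then ∏ i, ((α i).factorial : ℂ) else 0

open MeasureTheory in
/-- Independent Gaussian vectors, one for each `a : A`, form together a Gaussian vector. -/
theorem IsComplexGaussian.pi {Ω A σ : Type*} [MeasurableSpace Ω] [Fintype A] [Fintype σ]
    {μ : Measure Ω} [IsProbabilityMeasure μ] {g : Ω → σ → ℂ} (hg : IsComplexGaussian μ g) :
    IsComplexGaussian (Measure.pi fun _ : A => μ)
      (fun ω (i : A × σ) => g (ω i.1) i.2) := by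
  have key (α β : A × σ → ℕ) (ω : A → Ω) :
      star (∏ i : A × σ, g (ω i.1) i.2 ^ α i) * ∏ i : A × σ, g (ω i.1) i.2 ^ β i =
        ∏ a, (star (∏ i, g (ω a) i ^ α (a, i)) * ∏ i, g (ω a) i ^ β (a, i)) := by
    simp only [Fintype.prod_prod_type, star_prod, ← Finset.prod_mul_distrib]
  constructor
  · intro α β
    simp only [key]
    exact Integrable.fintype_prod (μ := fun _ => μ) fun a =>
      hg.integrable (fun i => α (a, i)) (fun i => β (a, i))
  · intro α β
    simp only [key]
    rw [integral_fintype_prod_eq_prod (μ := fun _ => μ)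
      (fun a ω => star (∏ i, g ω i ^ α (a, i)) * ∏ i, g ω i ^ β (a, i))]
    simp only [hg.moment (fun i => α (_, i)) (fun i => β (_, i))]
    split_ifs with h
    · subst h; simp [Fintype.prod_prod_type]
    · have : ∃ a, (fun i => α (a, i)) ≠ fun i => β (a, i) := by
        by_contra! h'
        exact h (funext fun i => congrFun (h' i.1) i.2)
      obtain ⟨a, ha⟩ := this
      exact Finset.prod_eq_zero (Finset.mem_univ a) (by simp [ha])

open MeasureTheory in
theorem isComplexGaussian_polarGaussian (σ : Type*) [Fintype σ] :
    IsComplexGaussian (Measure.pi fun _ : σ => polarMeasure)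
      (fun ω i => polarGaussian (ω i)) := by
  have key (α β : σ → ℕ) (ω : σ → ℝ × UnitAddCircle) :
      star (∏ i, polarGaussian (ω i) ^ α i) * ∏ i, polarGaussian (ω i) ^ β i =
        ∏ i, (star (polarGaussian (ω i) ^ α i) * polarGaussian (ω i) ^ β i) := by
    simp only [star_prod, ← Finset.prod_mul_distrib]
  constructor
  · intro α β
    simp only [key]
    exact Integrable.fintype_prod (μ := fun _ => polarMeasure) fun i =>
      integrable_polarGaussian (α i) (β i)
  · intro α β
    simp only [key]
    rw [integral_fintype_prod_eq_prod (μ := fun _ => polarMeasure)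
      (fun i p => star (polarGaussian p ^ α i) * polarGaussian p ^ β i)]
    simp only [integral_polarGaussian]
    split_ifs with h
    · subst h; simp
    · obtain ⟨i, hi⟩ := Function.ne_iff.1 h
      exact Finset.prod_eq_zero (Finset.mem_univ i) (by simp [hi])

/-! ### Polynomials in a Gaussian vector -/

section Fischer

open MeasureTheory MvPolynomial

variable {Ω σ : Type*} [MeasurableSpace Ω] {μ : Measure Ω} {g : Ω → σ → ℂ}

/-- The inner product `𝔼 [conj (p g) * q g]` of two polynomials in the Gaussian vector `g`. -/
noncomputable def fischer (μ : Measure Ω) (g : Ω → σ → ℂ) (p q : MvPolynomial σ ℂ) : ℂ :=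
  ∫ ω, star (eval (g ω) p) * eval (g ω) q ∂μ

theorem star_fischer (p q : MvPolynomial σ ℂ) : star (fischer μ g p q) = fischer μ g q p := by
  simp only [fischer]
  rw [Complex.star_def, ← integral_conj]
  simp [mul_comm]

theorem fischer_C_mul_right (c : ℂ) (p q : MvPolynomial σ ℂ) :
    fischer μ g p (C c * q) = c * fischer μ g p q := by
  simp only [fischer, ← integral_const_mul, eval_mul, eval_C]
  congr with ω
  ring

theorem fischer_self (p : MvPolynomial σ ℂ) :
    fischer μ g p p = ((∫ ω, ‖eval (g ω) p‖ ^ 2 ∂μ : ℝ) : ℂ) := by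
  rw [fischer, ← integral_complex_ofReal]
  congr with ω
  rw [Complex.star_def, Complex.conj_mul']
  simp

variable [Fintype σ]

theorem IsComplexGaussian.integrable_eval (hg : IsComplexGaussian μ g) (p q : MvPolynomial σ ℂ) :
    Integrable (fun ω => star (eval (g ω) p) * eval (g ω) q) μ := by
  simp only [eval_eq' , star_sum, Finset.sum_mul, Finset.mul_sum]
  refine integrable_finsetSum _ fun α _ => integrable_finsetSum _ fun β _ => ?_
  refine ((hg.integrable β α).const_mul (star (coeff β p) * coeff α q)).congr (.of_forall ?_)
  intro ω
  simp only [star_mul']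
  ring

theorem IsComplexGaussian.fischer_add_left (hg : IsComplexGaussian μ g)
    (p p' q : MvPolynomial σ ℂ) : fischer μ g (p + p') q = fischer μ g p q + fischer μ g p' q := by
  simp only [fischer, map_add, star_add, add_mul]
  exact integral_add (hg.integrable_eval _ _) (hg.integrable_eval _ _)

theorem IsComplexGaussian.fischer_add_right (hg : IsComplexGaussian μ g)
    (p q q' : MvPolynomial σ ℂ) : fischer μ g p (q + q') = fischer μ g p q + fischer μ g p q' := by
  simp only [fischer, map_add, mul_add]
  exact integral_add (hg.integrable_eval _ _) (hg.integrable_eval _ _)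

theorem IsComplexGaussian.fischer_sum_left (hg : IsComplexGaussian μ g) {ι : Type*}
    (s : Finset ι) (p : ι → MvPolynomial σ ℂ) (q : MvPolynomial σ ℂ) :
    fischer μ g (∑ i ∈ s, p i) q = ∑ i ∈ s, fischer μ g (p i) q := by
  simp only [fischer, map_sum, star_sum, Finset.sum_mul]
  exact integral_finsetSum _ fun i _ => hg.integrable_eval _ _

theorem IsComplexGaussian.fischer_sum_right (hg : IsComplexGaussian μ g) {ι : Type*}
    (s : Finset ι) (p : MvPolynomial σ ℂ) (q : ι → MvPolynomial σ ℂ) :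
    fischer μ g p (∑ i ∈ s, q i) = ∑ i ∈ s, fischer μ g p (q i) := by
  simp only [fischer, map_sum, Finset.mul_sum]
  exact integral_finsetSum _ fun i _ => hg.integrable_eval _ _

theorem IsComplexGaussian.integrable_normSq (hg : IsComplexGaussian μ g) (p : MvPolynomial σ ℂ) :
    Integrable (fun ω => ‖eval (g ω) p‖ ^ 2) μ := by
  refine (hg.integrable_eval p p).re.congr (.of_forall fun ω => ?_)
  simp only [Complex.star_def, Complex.conj_mul']
  norm_cast

theorem IsComplexGaussian.fischer_monomial (hg : IsComplexGaussian μ g) (α β : σ →₀ ℕ) (a b : ℂ) :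
    fischer μ g (monomial α a) (monomial β b) =
      if α = β then star a * b * ∏ i, ((α i).factorial : ℂ) else 0 := by
  have h := hg.moment α β
  simp only [DFunLike.coe_fn_eq] at h
  simp only [fischer, eval_monomial, Finsupp.prod_fintype, pow_zero, implies_true, star_mul']
  rw [← mul_ite_zero, ← h, ← integral_const_mul]
  congr with ω
  ring

/-- Multiplication by a variable and differentiation with respect to it are adjoint to each other:
Gaussian integration by parts. -/
theorem IsComplexGaussian.fischer_X_mul_left (hg : IsComplexGaussian μ g) (i : σ)
    (p q : MvPolynomial σ ℂ) : fischer μ g (X i * p) q = fischer μ g p (pderiv i q) := by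
  classical
  induction p using MvPolynomial.induction_on' with
  | add p p' hp hp' => rw [mul_add, hg.fischer_add_left, hg.fischer_add_left, hp, hp']
  | monomial α a =>
    induction q using MvPolynomial.induction_on' with
    | add q q' hq hq' => rw [map_add, hg.fischer_add_right, hg.fischer_add_right, hq, hq']
    | monomial β b =>
      rw [X, monomial_mul, pderiv_monomial, hg.fischer_monomial, hg.fischer_monomial]
      obtain hβ | hβ := Nat.eq_zero_or_pos (β i)
      · rw [if_neg]
        · simp [hβ]
        · intro h
          have := DFunLike.congr_fun h i
          simp [hβ] at this
      · obtain ⟨β, rfl⟩ : ∃ β', β = Finsupp.single i 1 + β' :=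
          ⟨β - Finsupp.single i 1, by
            rw [add_tsub_cancel_of_le]; rwa [Finsupp.single_le_iff]⟩
        simp only [add_right_inj, add_tsub_cancel_left]
        split_ifs with h
        · subst h
          have : ∏ j, (((Finsupp.single i 1 + α : σ →₀ ℕ) j).factorial : ℂ) =
              (α i + 1) * ∏ j, ((α j).factorial : ℂ) := by
            rw [← Finset.mul_prod_erase _ _ (Finset.mem_univ i),
              ← Finset.mul_prod_erase Finset.univ (fun j => ((α j).factorial : ℂ))
                (Finset.mem_univ i), ← mul_assoc]
            congr 1
            · simp [add_comm 1, Nat.factorial_succ]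
            · refine Finset.prod_congr rfl fun j hj => ?_
              rw [Finsupp.add_apply, Finsupp.single_eq_of_ne (Finset.ne_of_mem_erase hj), zero_add]
          rw [this]
          simp
          ring
        · rfl

theorem IsComplexGaussian.fischer_X_mul_right (hg : IsComplexGaussian μ g) (i : σ)
    (p q : MvPolynomial σ ℂ) : fischer μ g p (X i * q) = fischer μ g (pderiv i p) q := by
  rw [← star_fischer, hg.fischer_X_mul_left, star_fischer]

/-- The commutation relation between multiplication by variables and differentiation gives
`‖∑ₖ xₖ pₖ q‖² = ∑ₖ ‖pₖ q‖² + 𝔼 |∑ₖ conj pₖ ∂ₖ q|²`, when the `pₖ` do not contain the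
variables `xₖ`. -/
theorem IsComplexGaussian.sum_integral_normSq_le (hg : IsComplexGaussian μ g) {κ : Type*} [Fintype κ]
    (e : κ → σ) (he : Function.Injective e) (p : κ → MvPolynomial σ ℂ)
    (hp : ∀ k l, pderiv (e l) (p k) = 0) (q : MvPolynomial σ ℂ) :
    ∑ k, ∫ ω, ‖eval (g ω) (p k * q)‖ ^ 2 ∂μ ≤
      ∫ ω, ‖eval (g ω) ((∑ k, X (e k) * p k) * q)‖ ^ 2 ∂μ := by
  classical
  have hd (k l : κ) : pderiv (e l) (p k * q) = p k * pderiv (e l) q := by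
    rw [pderiv_mul, hp, zero_mul, zero_add]
  have h1 : fischer μ g ((∑ k, X (e k) * p k) * q) ((∑ k, X (e k) * p k) * q) =
      ∑ k, fischer μ g (p k * q) (p k * q) +
        ∑ k, ∑ l, fischer μ g (p k * pderiv (e l) q) (p l * pderiv (e k) q) := by
    rw [Finset.sum_mul, hg.fischer_sum_left, ← Finset.sum_add_distrib]
    refine Finset.sum_congr rfl fun k _ => ?_
    rw [mul_assoc, hg.fischer_X_mul_left, map_sum]
    simp only [mul_assoc, pderiv_mul (f := X _), pderiv_X, hd, Finset.sum_add_distrib]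
    rw [hg.fischer_add_right, hg.fischer_sum_right, hg.fischer_sum_right]
    refine congrArg₂ (· + ·) ?_ ?_
    · rw [Finset.sum_eq_single k]
      · simp
      · intro l _ hl
        rw [Pi.single_eq_of_ne (by simpa using he.ne hl)]
        simp [fischer]
      · simp
    · refine Finset.sum_congr rfl fun l _ => ?_
      rw [hg.fischer_X_mul_right, hd]
  have h2 : ∑ k, ∑ l, fischer μ g (p k * pderiv (e l) q) (p l * pderiv (e k) q) =
      ((∫ ω, ‖∑ k, star (eval (g ω) (p k)) * eval (g ω) (pderiv (e k) q)‖ ^ 2 ∂μ : ℝ) : ℂ) := by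
    have hi (k l : κ) := hg.integrable_eval (p k * pderiv (e l) q) (p l * pderiv (e k) q)
    calc _ = ∫ ω, ∑ k, ∑ l, star (eval (g ω) (p k * pderiv (e l) q)) *
          eval (g ω) (p l * pderiv (e k) q) ∂μ := by
          rw [integral_finsetSum _ fun k _ => integrable_finsetSum _ fun l _ => hi k l]
          refine Finset.sum_congr rfl fun k _ => ?_
          rw [integral_finsetSum _ fun l _ => hi k l]
          rfl
      _ = ∫ ω, ((‖∑ k, star (eval (g ω) (p k)) * eval (g ω) (pderiv (e k) q)‖ ^ 2 : ℝ) : ℂ) ∂μ := by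
          refine integral_congr_ae (.of_forall fun ω => ?_)
          simp only
          push_cast
          rw [← Complex.mul_conj', map_sum, Finset.sum_mul_sum]
          refine Finset.sum_congr rfl fun k _ => Finset.sum_congr rfl fun l _ => ?_
          simp only [star_mul', map_mul, Complex.star_def, Complex.conj_conj]
          ring
      _ = _ := integral_complex_ofReal
  rw [h2] at h1
  simp only [fischer_self, ← Complex.ofReal_sum, ← Complex.ofReal_add, Complex.ofReal_inj] at h1
  rw [h1]
  exact le_add_of_nonneg_right (integral_nonneg fun ω => by positivity)

/-- Multiplication by a multilinear form in disjoint blocks of variables increases the Gaussian norm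
at least by the factor that is the norm of the form. -/
theorem IsComplexGaussian.multilinear_mul_le (hg : IsComplexGaussian μ g) {κ : Type*} [Fintype κ]
    {n : ℕ} (e : Fin n → κ → σ) (he : Function.Injective fun x : Fin n × κ => e x.1 x.2)
    (v : (Fin n → κ) → ℂ) (q : MvPolynomial σ ℂ) :
    (∑ x, ‖v x‖ ^ 2) * ∫ ω, ‖eval (g ω) q‖ ^ 2 ∂μ ≤
      ∫ ω, ‖eval (g ω) ((∑ x, C (v x) * ∏ i, X (e i (x i))) * q)‖ ^ 2 ∂μ := by
  induction n with
  | zero => simp [mul_pow, integral_const_mul]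
  | succ n ih =>
    have he' : Function.Injective fun x : Fin n × κ => e x.1.succ x.2 := by
      intro x y h
      have := he (a₁ := (x.1.succ, x.2)) (a₂ := (y.1.succ, y.2)) h
      simpa [Prod.ext_iff] using this
    have h1 : ∑ x : Fin (n + 1) → κ, C (v x) * ∏ i, X (e i (x i)) =
        ∑ k, X (e 0 k) * ∑ y : Fin n → κ, C (v (Fin.cons k y)) * ∏ i : Fin n, X (e i.succ (y i)) := by
      rw [← (Fin.consEquiv fun _ => κ).sum_comp, Fintype.sum_prod_type]
      refine Finset.sum_congr rfl fun k _ => ?_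
      rw [Finset.mul_sum]
      refine Finset.sum_congr rfl fun y _ => ?_
      simp [Fin.consEquiv, Fin.prod_univ_succ]
      ring
    rw [h1]
    refine le_trans ?_ (hg.sum_integral_normSq_le (e 0) (fun k l h => ?_) _ (fun k l => ?_) q)
    · rw [← (Fin.consEquiv fun _ => κ).sum_comp, Fintype.sum_prod_type, Finset.sum_mul]
      exact Finset.sum_le_sum fun k _ => ih (fun i => e i.succ) he' fun y => v (Fin.cons k y)
    · simpa using he (a₁ := (0, k)) (a₂ := (0, l)) h
    · rw [map_sum]
      refine Finset.sum_eq_zero fun y _ => ?_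
      rw [pderiv_C_mul, mul_eq_zero]
      right
      refine Finset.prod_induction _ (fun r => pderiv (e 0 l) r = 0)
        (fun r r' hr hr' => by rw [pderiv_mul, hr, hr', zero_mul, mul_zero, zero_add])
        pderiv_one fun i _ => pderiv_X_of_ne fun h => ?_
      have := he (a₁ := (i.succ, y i)) (a₂ := (0, l)) h
      simp at this

/-- Integration by parts and Euler's identity: a factor `|g|²` contributes the dimension plus the
degree. -/
theorem IsComplexGaussian.integral_sqNorm_pow_mul (hg : IsComplexGaussian μ g) (T : ℕ) {k : ℕ}
    {p q : MvPolynomial σ ℂ} (hp : p.IsHomogeneous k) (hq : q.IsHomogeneous k) :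
    Integrable (fun ω => ((∑ i, ‖g ω i‖ ^ 2 : ℝ) : ℂ) ^ T *
        (star (eval (g ω) p) * eval (g ω) q)) μ ∧
      ∫ ω, ((∑ i, ‖g ω i‖ ^ 2 : ℝ) : ℂ) ^ T * (star (eval (g ω) p) * eval (g ω) q) ∂μ =
        (∏ j ∈ Finset.range T, ((Fintype.card σ : ℂ) + k + j)) * fischer μ g p q := by
  induction T generalizing k p q with
  | zero => simpa [fischer] using hg.integrable_eval p q
  | succ T ih =>
    have key (ω : Ω) : ((∑ i, ‖g ω i‖ ^ 2 : ℝ) : ℂ) ^ (T + 1) *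
        (star (eval (g ω) p) * eval (g ω) q) = ∑ i, ((∑ i, ‖g ω i‖ ^ 2 : ℝ) : ℂ) ^ T *
          (star (eval (g ω) (X i * p)) * eval (g ω) (X i * q)) := by
      rw [← Finset.mul_sum, pow_succ, mul_assoc]
      congr 1
      push_cast
      rw [Finset.sum_mul]
      refine Finset.sum_congr rfl fun i _ => ?_
      rw [← Complex.mul_conj']
      simp
      ring
    have h (i : σ) := ih ((isHomogeneous_X ℂ i).mul hp) ((isHomogeneous_X ℂ i).mul hq)
    simp only [key]
    refine ⟨integrable_finsetSum _ fun i _ => (h i).1, ?_⟩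
    rw [integral_finsetSum _ fun i _ => (h i).1]
    simp only [(h _).2]
    rw [← Finset.mul_sum, Finset.prod_range_succ', mul_assoc]
    congr 1
    · refine Finset.prod_congr rfl fun j _ => ?_
      push_cast
      ring
    · classical
      have h1 (i : σ) : fischer μ g (X i * p) (X i * q) =
          fischer μ g p q + fischer μ g p (X i * pderiv i q) := by
        rw [hg.fischer_X_mul_left, pderiv_mul, pderiv_X_self, one_mul, hg.fischer_add_right]
      simp only [h1]
      rw [Finset.sum_add_distrib, ← hg.fischer_sum_right _ p fun i => X i * pderiv i q, hq.sum_X_mul_pderiv,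
        nsmul_eq_mul, ← map_natCast (C : ℂ →+* MvPolynomial σ ℂ), fischer_C_mul_right]
      simp
      ring

end Fischer

/-! ### Tensor products and adaptive measurements -/

theorem tensorOp_mul {ι : Type} [Fintype ι] [DecidableEq ι] {T : ℕ} (X Y : Fin T → Matrix ι ι ℂ) :
    tensorOp X * tensorOp Y = tensorOp fun t => X t * Y t := by
  ext x y
  simp only [tensorOp, Matrix.mul_apply, Matrix.of_apply, ← Finset.prod_mul_distrib]
  rw [Finset.prod_univ_sum, Fintype.piFinset_univ]

theorem trace_tensorOp {ι : Type} [Fintype ι] [DecidableEq ι] {T : ℕ} (X : Fin T → Matrix ι ι ℂ) :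
    (tensorOp X).trace = ∏ t, (X t).trace := by
  simp only [tensorOp, Matrix.trace, Matrix.diag_apply, Matrix.of_apply]
  rw [Finset.prod_univ_sum, Fintype.piFinset_univ]

theorem trace_tensorOp_mul_copies {ι : Type} [Fintype ι] [DecidableEq ι] {T : ℕ}
    (X : Fin T → Matrix ι ι ℂ) (ψ : EuclideanSpace ℂ ι) :
    (tensorOp X * copies T ψ).trace = ∏ t, (X t * ketBra ψ).trace := by
  rw [copies, tensorOp_mul, trace_tensorOp]

open scoped MatrixOrder in
theorem Matrix.PosSemidef.exists_eq_conjTranspose_mul_self {ι : Type} [Fintype ι] [DecidableEq ι]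
    {X : Matrix ι ι ℂ} (hX : X.PosSemidef) : ∃ B : Matrix ι ι ℂ, X = Bᴴ * B :=
  CStarAlgebra.nonneg_iff_eq_star_mul_self.mp hX.nonneg

theorem trace_conjTranspose_mul_self {ι : Type} [Fintype ι] (B : Matrix ι ι ℂ) :
    (Bᴴ * B).trace = ((∑ j, ∑ x, ‖B j x‖ ^ 2 : ℝ) : ℂ) := by
  simp only [Matrix.trace, Matrix.diag_apply, Matrix.mul_apply, Matrix.conjTranspose_apply]
  rw [Finset.sum_comm]
  push_cast
  simp only [← Complex.conj_mul', Complex.star_def]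

theorem trace_conjTranspose_mul_self_mul_ketBra {ι : Type} [Fintype ι] (B : Matrix ι ι ℂ)
    (ψ : EuclideanSpace ℂ ι) :
    (Bᴴ * B * ketBra ψ).trace = ((∑ j, ‖∑ x, B j x * ψ x‖ ^ 2 : ℝ) : ℂ) := by
  rw [Matrix.mul_assoc, Matrix.trace_mul_comm, Matrix.mul_assoc]
  simp only [Matrix.trace, Matrix.diag_apply, Matrix.mul_apply, Matrix.conjTranspose_apply,
    ketBra, Matrix.of_apply]
  push_cast
  refine Finset.sum_congr rfl fun j _ => ?_
  rw [← Complex.mul_conj', map_sum, Finset.sum_mul_sum]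
  refine Finset.sum_congr rfl fun x _ => ?_
  rw [Finset.mul_sum]
  refine Finset.sum_congr rfl fun y _ => ?_
  simp only [Complex.star_def, map_mul]
  ring

/-- The elements of a family of POVMs, each chosen depending on the earlier outcomes, sum up to the
identity. -/
theorem sum_tensorOp_adaptive {ι : Type} [DecidableEq ι] (N : ℕ) {T : ℕ}
    (E : (t : Fin T) → (Fin t → ℕ) → ℕ → Matrix ι ι ℂ)
    (hE : ∀ t h, ∑ k ∈ Finset.range N, E t h k = 1) :
    ∑ ℓ ∈ Fintype.piFinset fun _ : Fin T => Finset.range N,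
      tensorOp (fun t : Fin T => E t (fun s => ℓ (Fin.castLE t.isLt.le s)) (ℓ t)) = 1 := by
  induction T with
  | zero =>
    ext x y
    simp [tensorOp, Matrix.one_apply, Subsingleton.elim x y]
  | succ T ih =>
    ext x y
    have ih' := congrFun (congrFun (ih (fun t => E t.castSucc) fun t => hE t.castSucc)
      (Fin.init x)) (Fin.init y)
    have hl (h : Fin T → ℕ) :=
      congrFun (congrFun (hE (Fin.last T) h) (x (Fin.last T))) (y (Fin.last T))
    simp only [Matrix.sum_apply, tensorOp, Matrix.of_apply] at ih' hl ⊢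
    have h1 : ∑ ℓ ∈ Fintype.piFinset fun _ : Fin (T + 1) => Finset.range N,
        ∏ t : Fin (T + 1), E t (fun s => ℓ (Fin.castLE t.isLt.le s)) (ℓ t) (x t) (y t) =
        ∑ p ∈ (Fintype.piFinset fun _ : Fin T => Finset.range N) ×ˢ Finset.range N,
          (∏ t : Fin T, E t.castSucc (fun s => p.1 (Fin.castLE t.isLt.le s)) (p.1 t)
            (x t.castSucc) (y t.castSucc)) * E (Fin.last T) p.1 p.2 (x (Fin.last T))
              (y (Fin.last T)) := by
      refine Finset.sum_bij' (fun ℓ _ => (Fin.init ℓ, ℓ (Fin.last T)))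
        (fun p _ => Fin.snoc (α := fun _ => ℕ) p.1 p.2) ?_ ?_ ?_ ?_ ?_
      · intro ℓ hℓ
        simp only [Fintype.mem_piFinset, Finset.mem_product] at hℓ ⊢
        exact ⟨fun i => hℓ i.castSucc, hℓ _⟩
      · intro p hp
        simp only [Fintype.mem_piFinset, Finset.mem_product] at hp ⊢
        refine Fin.lastCases ?_ fun i => ?_
        · simpa using hp.2
        · simpa using hp.1 i
      · intro ℓ _
        simp
      · intro p _
        simp
      · intro ℓ _
        rw [Fin.prod_univ_castSucc]
        rfl
    rw [h1, Finset.sum_product]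
    simp only [← Finset.mul_sum, hl]
    rw [← Finset.sum_mul]
    refine (congrArg (· * _) ih').trans ?_
    simp only [Matrix.one_apply, ← ite_and, mul_ite, mul_one, mul_zero]
    congr 1
    rw [← Fin.snoc_init_self x, ← Fin.snoc_init_self y]
    simp only [Fin.snoc_last, Fin.init_snoc, Fin.snoc_inj, eq_iff_iff]
    exact and_comm

theorem POVM.posSemidef_one_sub_sum {ι : Type} [Fintype ι] [DecidableEq ι] (E : POVM ι)
    (s : Finset ℕ) : (1 - ∑ k ∈ s, E.effect k).PosSemidef := by
  refine .of_dotProduct_mulVec_nonneg ?_ fun v => ?_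
  · exact Matrix.isHermitian_one.sub
      (Matrix.posSemidef_sum s fun k _ => E.posSemidef k).isHermitian
  · let Φ : Matrix ι ι ℂ →+ ℂ :=
      { toFun := fun X => star v ⬝ᵥ X *ᵥ v
        map_zero' := by simp
        map_add' := fun X Y => by rw [Matrix.add_mulVec, dotProduct_add] }
    have hΦ : Continuous Φ := by
      change Continuous fun X : Matrix ι ι ℂ => star v ⬝ᵥ X *ᵥ v
      fun_prop
    have h := sum_le_hasSum s (fun k _ => (E.posSemidef k).dotProduct_mulVec_nonneg v)
      (E.complete.map Φ hΦ)
    change 0 ≤ Φ _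
    rw [map_sub, map_sum, sub_nonneg]
    exact h

/-- The element `k` of `E` for `k < K`, and all remaining outcomes merged into `K`. -/
noncomputable def POVM.truncate {ι : Type} [Fintype ι] [DecidableEq ι] (E : POVM ι) (K k : ℕ) :
    Matrix ι ι ℂ :=
  if k < K then E.effect k else 1 - ∑ j ∈ Finset.range K, E.effect j

theorem POVM.posSemidef_truncate {ι : Type} [Fintype ι] [DecidableEq ι] (E : POVM ι) (K k : ℕ) :
    (E.truncate K k).PosSemidef := by
  unfold POVM.truncate
  split_ifs
  · exact E.posSemidef k
  · exact E.posSemidef_one_sub_sum _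

theorem POVM.sum_truncate {ι : Type} [Fintype ι] [DecidableEq ι] (E : POVM ι) (K : ℕ) :
    ∑ k ∈ Finset.range (K + 1), E.truncate K k = 1 := by
  have h : ∑ k ∈ Finset.range K, E.truncate K k = ∑ k ∈ Finset.range K, E.effect k :=
    Finset.sum_congr rfl fun k hk => if_pos (Finset.mem_range.1 hk)
  rw [Finset.sum_range_succ, h]
  simp [POVM.truncate]

/-- A linear functional that is nonnegative on tensor products of positive operators takes on the
accepting operator `M` of an adaptive single-copy algorithm a value between `0` and its value at the
identity. -/
theorem IsAdaptiveSingleCopy.map_nonneg_and_le {ι : Type} [Fintype ι] [DecidableEq ι] {T : ℕ}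
    {M : Matrix (Fin T → ι) (Fin T → ι) ℂ} (hM : IsAdaptiveSingleCopy M)
    (Λ : Matrix (Fin T → ι) (Fin T → ι) ℂ →ₗ[ℝ] ℝ)
    (hΛ : ∀ X : Fin T → Matrix ι ι ℂ, (∀ t, (X t).PosSemidef) → 0 ≤ Λ (tensorOp X)) :
    0 ≤ Λ M ∧ Λ M ≤ Λ 1 := by
  obtain ⟨A, f, hf, hsum⟩ := hM
  have hpos (ℓ : Fin T → ℕ) : 0 ≤ Λ (A.outcomeOp ℓ) :=
    hΛ _ fun t => (A.povm t _).posSemidef _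
  have hΛM : HasSum (fun ℓ => f ℓ * Λ (A.outcomeOp ℓ)) (Λ M) := by
    have h := hsum.map Λ (LinearMap.continuous_of_finiteDimensional Λ)
    have h1 (ℓ : Fin T → ℕ) : Λ ((f ℓ : ℂ) • A.outcomeOp ℓ) = f ℓ * Λ (A.outcomeOp ℓ) := by
      rw [Complex.coe_smul, map_smul, smul_eq_mul]
    simpa only [Function.comp_def, h1] using h
  refine ⟨hΛM.nonneg fun ℓ => mul_nonneg (hf ℓ).1 (hpos ℓ), hasSum_le_of_sum_le hΛM fun s => ?_⟩
  -- It suffices to bound finite partial sums. Such a sum involves only outcomes below some `K`, and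
  -- then merging the other outcomes makes the total sum finite, with value `1`.
  obtain ⟨K, hK⟩ : ∃ K : ℕ, ∀ ℓ ∈ s, ∀ t, ℓ t < K := by
    refine ⟨(s.sup fun ℓ => Finset.univ.sup ℓ) + 1, fun ℓ hℓ t => Nat.lt_succ_of_le ?_⟩
    exact (Finset.le_sup (f := ℓ) (Finset.mem_univ t)).trans
      (Finset.le_sup (f := fun ℓ : Fin T → ℕ => Finset.univ.sup ℓ) hℓ)
  let O (ℓ : Fin T → ℕ) : Matrix (Fin T → ι) (Fin T → ι) ℂ :=
    tensorOp fun t => (A.povm t fun s => ℓ (Fin.castLE t.isLt.le s)).truncate K (ℓ t)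
  have hO (ℓ : Fin T → ℕ) : 0 ≤ Λ (O ℓ) := hΛ _ fun t => POVM.posSemidef_truncate _ _ _
  calc ∑ ℓ ∈ s, f ℓ * Λ (A.outcomeOp ℓ) ≤ ∑ ℓ ∈ s, Λ (O ℓ) := by
        refine Finset.sum_le_sum fun ℓ hℓ => ?_
        have : O ℓ = A.outcomeOp ℓ := by
          simp only [O, AdaptiveStrategy.outcomeOp, POVM.truncate, if_pos (hK ℓ hℓ _)]
        rw [this]
        exact mul_le_of_le_one_left (hpos ℓ) (hf ℓ).2
    _ ≤ ∑ ℓ ∈ Fintype.piFinset fun _ : Fin T => Finset.range (K + 1), Λ (O ℓ) := by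
        refine Finset.sum_le_sum_of_subset_of_nonneg (fun ℓ hℓ => ?_) fun ℓ _ _ => hO ℓ
        simp only [Fintype.mem_piFinset, Finset.mem_range]
        exact fun t => (hK ℓ hℓ t).trans (Nat.lt_succ_self K)
    _ = Λ 1 := by
        rw [← map_sum, sum_tensorOp_adaptive (K + 1) (fun t h => (A.povm t h).truncate K)
          fun t h => POVM.sum_truncate _ K]

/-! ### Expected acceptance probabilities -/

section MomentBound

open MeasureTheory MvPolynomial

variable {Ω σ : Type*} [MeasurableSpace Ω] [Fintype σ] {μ : Measure Ω} {g : Ω → σ → ℂ}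

/-- The vector with amplitudes `P x`, evaluated at `z`; it is not normalized. Both random states,
`g` and `g₁ ⊗ ⋯ ⊗ gₙ`, are of this form. -/
noncomputable def polyState {ι : Type} (P : ι → MvPolynomial σ ℂ) (z : σ → ℂ) :
    EuclideanSpace ℂ ι := WithLp.toLp 2 fun x => eval z (P x)

theorem IsComplexGaussian.integrable_prod_sum_normSq (hg : IsComplexGaussian μ g)
    {τ J : Type*} [Fintype J] (L : τ → J → MvPolynomial σ ℂ) (s : Finset τ)
    (q : MvPolynomial σ ℂ) :
    Integrable (fun ω => (∏ t ∈ s, ∑ j, ‖eval (g ω) (L t j)‖ ^ 2) * ‖eval (g ω) q‖ ^ 2) μ := by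
  classical
  induction s using Finset.induction_on generalizing q with
  | empty => simpa using hg.integrable_normSq q
  | insert t s hts ih =>
    refine (integrable_finsetSum Finset.univ fun j _ => ih (L t j * q)).congr (.of_forall fun ω => ?_)
    simp only [Finset.prod_insert hts, eval_mul, norm_mul, mul_pow]
    rw [← Finset.mul_sum, ← Finset.sum_mul]
    ring

/-- The inequality `hP`, used once for each factor: the polynomial `q` absorbs the factors that have
been treated. -/
theorem IsComplexGaussian.prod_mul_le_integral (hg : IsComplexGaussian μ g)
    {ι : Type} [Fintype ι] {P : ι → MvPolynomial σ ℂ}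
    (hP : ∀ (v : ι → ℂ) (q : MvPolynomial σ ℂ), (∑ x, ‖v x‖ ^ 2) * ∫ ω, ‖eval (g ω) q‖ ^ 2 ∂μ ≤
      ∫ ω, ‖eval (g ω) ((∑ x, C (v x) * P x) * q)‖ ^ 2 ∂μ)
    {τ J : Type*} [Fintype J] (B : τ → J → ι → ℂ) (s : Finset τ) (q : MvPolynomial σ ℂ) :
    (∏ t ∈ s, ∑ j, ∑ x, ‖B t j x‖ ^ 2) * ∫ ω, ‖eval (g ω) q‖ ^ 2 ∂μ ≤
      ∫ ω, (∏ t ∈ s, ∑ j, ‖eval (g ω) (∑ x, C (B t j x) * P x)‖ ^ 2) *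
        ‖eval (g ω) q‖ ^ 2 ∂μ := by
  classical
  induction s using Finset.induction_on generalizing q with
  | empty => simp
  | insert t s hts ih =>
    have key (ω : Ω) : (∏ t ∈ insert t s, ∑ j, ‖eval (g ω) (∑ x, C (B t j x) * P x)‖ ^ 2) *
        ‖eval (g ω) q‖ ^ 2 = ∑ j, (∏ t ∈ s, ∑ j, ‖eval (g ω) (∑ x, C (B t j x) * P x)‖ ^ 2) *
          ‖eval (g ω) ((∑ x, C (B t j x) * P x) * q)‖ ^ 2 := by
      simp only [Finset.prod_insert hts, eval_mul, norm_mul, mul_pow]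
      rw [← Finset.mul_sum, ← Finset.sum_mul]
      ring
    simp only [key]
    rw [integral_finsetSum _ fun j _ => hg.integrable_prod_sum_normSq _ s _]
    refine le_trans ?_ (Finset.sum_le_sum fun j _ => ih _)
    rw [← Finset.mul_sum, Finset.prod_insert hts, mul_comm (∑ j, _), mul_assoc]
    refine mul_le_mul_of_nonneg_left ?_ (by positivity)
    rw [Finset.sum_mul]
    exact Finset.sum_le_sum fun j _ => hP _ _

theorem IsComplexGaussian.integrable_trace_mul_copies (hg : IsComplexGaussian μ g)
    {ι : Type} [Fintype ι] (P : ι → MvPolynomial σ ℂ) (q : MvPolynomial σ ℂ) {T : ℕ}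
    (N : Matrix (Fin T → ι) (Fin T → ι) ℂ) :
    Integrable (fun ω => ‖eval (g ω) q‖ ^ 2 * ((N * copies T (polyState P (g ω))).trace).re) μ := by
  have h : Integrable (fun ω => ∑ x, ∑ y, N x y * (star (eval (g ω) ((∏ t, P (x t)) * q)) *
      eval (g ω) ((∏ t, P (y t)) * q))) μ :=
    integrable_finsetSum _ fun x _ => integrable_finsetSum _ fun y _ =>
      (hg.integrable_eval _ _).const_mul _
  refine h.re.congr (.of_forall fun ω => ?_)
  simp only [RCLike.re_to_complex]
  rw [← Complex.re_ofReal_mul]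
  congr 1
  simp only [Matrix.trace, Matrix.diag_apply, Matrix.mul_apply, Finset.mul_sum]
  refine Finset.sum_congr rfl fun x _ => Finset.sum_congr rfl fun y _ => ?_
  push_cast
  rw [← Complex.conj_mul']
  simp only [copies, tensorOp, ketBra, polyState, Matrix.of_apply, eval_mul,
    Finset.prod_mul_distrib, star_mul', star_prod, Complex.star_def, map_prod]
  ring

/-- If a random state satisfies the norm inequality `hP`, then an adaptive single-copy algorithm
accepts it in expectation with at least the probability for the maximally mixed state, up to
normalization, and the same holds for rejection. The expectation may be weighted by `|q|²`. -/
theorem IsComplexGaussian.trace_le_integral (hg : IsComplexGaussian μ g)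
    {ι : Type} [Fintype ι] [DecidableEq ι] {P : ι → MvPolynomial σ ℂ}
    (hP : ∀ (v : ι → ℂ) (q : MvPolynomial σ ℂ), (∑ x, ‖v x‖ ^ 2) * ∫ ω, ‖eval (g ω) q‖ ^ 2 ∂μ ≤
      ∫ ω, ‖eval (g ω) ((∑ x, C (v x) * P x) * q)‖ ^ 2 ∂μ) (q : MvPolynomial σ ℂ)
    {T : ℕ} {M : Matrix (Fin T → ι) (Fin T → ι) ℂ} (hM : IsAdaptiveSingleCopy M) :
    (M.trace).re * ∫ ω, ‖eval (g ω) q‖ ^ 2 ∂μ ≤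
        ∫ ω, ‖eval (g ω) q‖ ^ 2 * ((M * copies T (polyState P (g ω))).trace).re ∂μ ∧
      ((1 - M).trace).re * ∫ ω, ‖eval (g ω) q‖ ^ 2 ∂μ ≤
        ∫ ω, ‖eval (g ω) q‖ ^ 2 * (((1 - M) * copies T (polyState P (g ω))).trace).re ∂μ := by
  let Λ : Matrix (Fin T → ι) (Fin T → ι) ℂ →ₗ[ℝ] ℝ :=
    { toFun := fun N => ∫ ω, ‖eval (g ω) q‖ ^ 2 * ((N * copies T (polyState P (g ω))).trace).re ∂μ -
        (N.trace).re * ∫ ω, ‖eval (g ω) q‖ ^ 2 ∂μ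
      map_add' := fun N N' => by
        simp only [add_mul, Matrix.trace_add, Complex.add_re, mul_add]
        rw [integral_add (hg.integrable_trace_mul_copies P q N)
          (hg.integrable_trace_mul_copies P q N')]
        ring
      map_smul' := fun c N => by
        simp only [Matrix.smul_mul, Matrix.trace_smul, Complex.smul_re, smul_eq_mul, RingHom.id_apply,
          mul_left_comm _ c]
        rw [integral_const_mul]
        ring }
  have hΛ (X : Fin T → Matrix ι ι ℂ) (hX : ∀ t, (X t).PosSemidef) : 0 ≤ Λ (tensorOp X) := by
    choose B hB using fun t => (hX t).exists_eq_conjTranspose_mul_self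
    refine sub_nonneg.2 ?_
    simp only [trace_tensorOp_mul_copies, trace_tensorOp, hB, trace_conjTranspose_mul_self,
      trace_conjTranspose_mul_self_mul_ketBra, ← Complex.ofReal_prod, Complex.ofReal_re]
    refine (hg.prod_mul_le_integral hP B Finset.univ q).trans_eq ?_
    congr with ω
    rw [mul_comm]
    simp only [polyState, map_sum, eval_mul, eval_C]
  obtain ⟨h1, h2⟩ := hM.map_nonneg_and_le Λ hΛ
  refine ⟨sub_nonneg.1 h1, sub_nonneg.1 ?_⟩
  rw [← sub_nonneg, ← map_sub] at h2
  exact h2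

end MomentBound

/-! ### Trace distance and purity of states near product states -/

theorem norm_sum_mul_sq_le {ι : Type*} [Fintype ι] (a b : ι → ℂ) :
    ‖∑ i, a i * b i‖ ^ 2 ≤ (∑ i, ‖a i‖ ^ 2) * ∑ i, ‖b i‖ ^ 2 := by
  refine le_trans ?_ (Finset.sum_mul_sq_le_sq_mul_sq Finset.univ (fun i => ‖a i‖) fun i => ‖b i‖)
  refine pow_le_pow_left₀ (norm_nonneg _) ((norm_sum_le _ _).trans_eq ?_) 2
  simp only [norm_mul]

theorem ketBra_eq_vecMulVec {ι : Type} (ψ : EuclideanSpace ℂ ι) :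
    ketBra ψ = Matrix.vecMulVec ψ (star (ψ : ι → ℂ)) := rfl

theorem isHermitian_ketBra {ι : Type} (ψ : EuclideanSpace ℂ ι) : (ketBra ψ).IsHermitian := by
  ext x y
  simp [ketBra, mul_comm]

theorem trace_ketBra {ι : Type} [Fintype ι] (ψ : EuclideanSpace ℂ ι) :
    (ketBra ψ).trace = ((‖ψ‖ ^ 2 : ℝ) : ℂ) := by
  rw [EuclideanSpace.norm_sq_eq]
  push_cast
  simp only [← Complex.mul_conj', Matrix.trace, Matrix.diag_apply, ketBra, Matrix.of_apply,
    Complex.star_def]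

theorem ketBra_mul_ketBra_mul_ketBra {ι : Type} [Fintype ι] (φ ψ : EuclideanSpace ℂ ι) :
    ketBra φ * ketBra ψ * ketBra φ =
      ((‖∑ x, star (φ x) * ψ x‖ ^ 2 : ℝ) : ℂ) • ketBra φ := by
  simp only [ketBra_eq_vecMulVec, Matrix.vecMulVec_mul_vecMulVec, Matrix.smul_mul,
    Matrix.vecMulVec_smul, smul_smul]
  congr 1
  push_cast
  rw [← Complex.conj_mul', map_sum]
  simp [dotProduct, mul_comm]

theorem trace_ketBra_mul_ketBra {ι : Type} [Fintype ι] (φ ψ : EuclideanSpace ℂ ι) :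
    (ketBra φ * ketBra ψ).trace = ((‖∑ x, star (φ x) * ψ x‖ ^ 2 : ℝ) : ℂ) := by
  simp only [ketBra_eq_vecMulVec, Matrix.vecMulVec_mul_vecMulVec, Matrix.trace_vecMulVec,
    Matrix.vecMulVec_smul, Matrix.trace_smul]
  push_cast
  rw [← Complex.conj_mul', map_sum]
  simp [dotProduct, mul_comm]

theorem ketBra_mul_self {ι : Type} [Fintype ι] {ψ : EuclideanSpace ℂ ι} (h : ‖ψ‖ = 1) :
    ketBra ψ * ketBra ψ = ketBra ψ := by
  have h1 : star (ψ : ι → ℂ) ⬝ᵥ (ψ : ι → ℂ) = 1 := by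
    have := trace_ketBra ψ
    rw [h] at this
    simpa [ketBra_eq_vecMulVec, Matrix.trace_vecMulVec, dotProduct_comm] using this
  simp only [ketBra_eq_vecMulVec, Matrix.vecMulVec_mul_vecMulVec, h1, one_smul]

/-- The inequality `√(1 - |⟨φ|ψ⟩|²) ≤ ½ ‖φ - ψ‖₁` (an equality, in fact). The matrix
`Y = (φ - ψ)²` satisfies `Y² = (1 - |⟨φ|ψ⟩|²) Y`, so that its nonzero eigenvalues are all equal to
`1 - |⟨φ|ψ⟩|²`, and their sum is known from the trace. -/
theorem sqrt_one_sub_le_traceDist {ι : Type} [Fintype ι] [DecidableEq ι]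
    {φ ψ : EuclideanSpace ℂ ι} (hφ : ‖φ‖ = 1) (hψ : ‖ψ‖ = 1) :
    √(1 - ‖∑ x, star (φ x) * ψ x‖ ^ 2) ≤ traceDist (ketBra φ) (ketBra ψ) := by
  have hc : ‖∑ x, star (ψ x) * φ x‖ = ‖∑ x, star (φ x) * ψ x‖ := by
    rw [← norm_star (∑ x, star (φ x) * ψ x)]
    simp [mul_comm]
  have hPQP := ketBra_mul_ketBra_mul_ketBra φ ψ
  have hQPQ := ketBra_mul_ketBra_mul_ketBra ψ φ
  have htr := trace_ketBra_mul_ketBra φ ψ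
  rw [hc] at hQPQ
  set s : ℝ := ‖∑ x, star (φ x) * ψ x‖ ^ 2
  have hPP := ketBra_mul_self hφ
  have hQQ := ketBra_mul_self hψ
  have hPt := trace_ketBra φ
  have hQt := trace_ketBra ψ
  have hX : (ketBra φ - ketBra ψ)ᴴ = ketBra φ - ketBra ψ :=
    (isHermitian_ketBra φ).sub (isHermitian_ketBra ψ)
  unfold traceDist traceNorm
  set hY := Matrix.isHermitian_conjTranspose_mul_self (ketBra φ - ketBra ψ)
  have hYt := hY.trace_eq_sum_eigenvalues
  have hnn (i : ι) : 0 ≤ hY.eigenvalues i :=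
    (Matrix.posSemidef_conjTranspose_mul_self (ketBra φ - ketBra ψ)).eigenvalues_nonneg i
  have hev (i : ι) := hY.mulVec_eigenvectorBasis i
  have hne (i : ι) : (hY.eigenvectorBasis i : ι → ℂ) ≠ 0 := fun h =>
    hY.eigenvectorBasis.orthonormal.ne_zero i (by ext x; exact congrFun h x)
  generalize hY.eigenvalues = ev at hYt hnn hev ⊢
  generalize hY.eigenvectorBasis = b at hev hne
  clear hY
  rw [hX] at hYt hev
  set P := ketBra φ
  set Q := ketBra ψ
  rw [hφ, one_pow, Complex.ofReal_one] at hPt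
  rw [hψ, one_pow, Complex.ofReal_one] at hQt
  have hPQQ : P * Q * Q = P * Q := by rw [mul_assoc, hQQ]
  have hQPP : Q * P * P = Q * P := by rw [mul_assoc, hPP]
  have hX3 : (P - Q) * (P - Q) * (P - Q) = ((1 - s : ℝ) : ℂ) • (P - Q) := by
    simp only [sub_mul, mul_sub, hPP, hQQ, hPQQ, hQPP, hPQP, hQPQ]
    push_cast
    module
  have hY2 : ((P - Q) * (P - Q)) * ((P - Q) * (P - Q)) =
      ((1 - s : ℝ) : ℂ) • ((P - Q) * (P - Q)) := by
    rw [← mul_assoc, hX3, Matrix.smul_mul]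
  have hev2 (i : ι) : ev i * ev i = (1 - s) * ev i := by
    have h := congrArg (fun Z => Z *ᵥ (b i : ι → ℂ)) hY2
    simp only at h
    rw [← Matrix.mulVec_mulVec, hev, Matrix.mulVec_smul, Matrix.smul_mulVec, hev] at h
    obtain ⟨x, hx⟩ := Function.ne_iff.1 (hne i)
    have hx' := congrFun h x
    simp only [Pi.smul_apply, Complex.real_smul, smul_eq_mul, ← mul_assoc] at hx'
    exact_mod_cast mul_right_cancel₀ hx hx'
  have hsum : ∑ i, ev i = 2 * (1 - s) := by
    have h1 : ((P - Q) * (P - Q)).trace = ((2 * (1 - s) : ℝ) : ℂ) := by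
      have h2 : (P - Q) * (P - Q) = P - P * Q - Q * P + Q := by
        simp only [sub_mul, mul_sub, hPP, hQQ]
        abel
      rw [h2, Matrix.trace_add, Matrix.trace_sub, Matrix.trace_sub, Matrix.trace_mul_comm Q P, htr,
        hPt, hQt]
      push_cast
      ring
    rw [h1] at hYt
    refine Complex.ofReal_injective ?_
    rw [hYt]
    push_cast
    rfl
  obtain hs | hs := le_or_gt (1 - s) 0
  · rw [Real.sqrt_eq_zero_of_nonpos hs]
    positivity
  · have h (i : ι) : √(1 - s) * √(ev i) = ev i := by
      rw [← Real.sqrt_mul hs.le, ← hev2, Real.sqrt_mul_self (hnn i)]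
    have h2 : √(1 - s) * ∑ i, √(ev i) = √(1 - s) * (2 * √(1 - s)) := by
      rw [Finset.mul_sum, Finset.sum_congr rfl fun i _ => h i, hsum]
      linear_combination (-2) * Real.mul_self_sqrt hs.le
    rw [mul_left_cancel₀ (Real.sqrt_pos.2 hs).ne' h2]
    linarith

/-- The purity `tr ρ²` of the reduced state `ρ` of the first qudit, for a vector `z` that need not be
normalized. -/
noncomputable def firstPurity {n d : ℕ} (z : QuditIdx (n + 1) d → ℂ) : ℝ :=
  ∑ i : Fin d, ∑ j : Fin d, ‖∑ y : Fin n → Fin d,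
    z (Fin.cons (α := fun _ => Fin d) i y) * star (z (Fin.cons (α := fun _ => Fin d) j y))‖ ^ 2

/-- The Cauchy–Schwarz inequality, applied twice: the overlap of `f` with a product vector is bounded
by the largest eigenvalue of the reduced state, and that by its Frobenius norm. -/
theorem norm_sum_mul_pow_four_le {A B : Type*} [Fintype A] [Fintype B] (a : A → ℂ) (b : B → ℂ)
    (f : A → B → ℂ) (ha : ∑ i, ‖a i‖ ^ 2 = 1) (hb : ∑ y, ‖b y‖ ^ 2 = 1) :
    ‖∑ i, ∑ y, a i * b y * f i y‖ ^ 4 ≤ ∑ i, ∑ j, ‖∑ y, f i y * star (f j y)‖ ^ 2 := by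
  have h1 : ‖∑ i, ∑ y, a i * b y * f i y‖ ^ 2 ≤ ∑ y, ‖∑ i, a i * f i y‖ ^ 2 := by
    have h := norm_sum_mul_sq_le b fun y => ∑ i, a i * f i y
    rw [hb, one_mul] at h
    convert h using 3
    rw [Finset.sum_comm]
    refine Finset.sum_congr rfl fun y _ => ?_
    rw [Finset.mul_sum]
    exact Finset.sum_congr rfl fun i _ => by ring
  have h2 : ((∑ y, ‖∑ i, a i * f i y‖ ^ 2 : ℝ) : ℂ) =
      ∑ p : A × A, (a p.1 * star (a p.2)) * ∑ y, f p.1 y * star (f p.2 y) := by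
    push_cast
    simp only [Finset.mul_sum]
    rw [Finset.sum_comm]
    refine Finset.sum_congr rfl fun y _ => ?_
    rw [← Complex.mul_conj', map_sum, Finset.sum_mul_sum, Fintype.sum_prod_type]
    refine Finset.sum_congr rfl fun i _ => Finset.sum_congr rfl fun j _ => ?_
    simp only [Complex.star_def, map_mul]
    ring
  have h3 : ‖((∑ y, ‖∑ i, a i * f i y‖ ^ 2 : ℝ) : ℂ)‖ ^ 2 ≤
      ∑ i, ∑ j, ‖∑ y, f i y * star (f j y)‖ ^ 2 := by
    rw [h2]
    refine (norm_sum_mul_sq_le _ _).trans_eq ?_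
    have : ∑ p : A × A, ‖a p.1 * star (a p.2)‖ ^ 2 = 1 := by
      simp only [norm_mul, norm_star, mul_pow, Fintype.sum_prod_type, ← Finset.mul_sum, ha, mul_one]
    rw [this, one_mul, Fintype.sum_prod_type]
  rw [Complex.norm_real, Real.norm_of_nonneg (by positivity)] at h3
  calc _ = (‖∑ i, ∑ y, a i * b y * f i y‖ ^ 2) ^ 2 := by ring
    _ ≤ _ := pow_le_pow_left₀ (by positivity) h1 2
    _ ≤ _ := h3

theorem sum_prod_normSq {n : ℕ} {κ : Type*} [Fintype κ] (a : Fin n → κ → ℂ) :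
    ∑ x : Fin n → κ, ‖∏ i, a i (x i)‖ ^ 2 = ∏ i, ∑ k, ‖a i k‖ ^ 2 := by
  classical
  rw [Finset.prod_univ_sum, Fintype.piFinset_univ]
  simp only [norm_prod, Finset.prod_pow]

/-- A state that is not `ε`-far from product has overlap more than `1 - ε²` with a product state, and
hence a first qudit of large purity. -/
theorem le_firstPurity_of_not_isFar {n d : ℕ} {ε : ℝ} (h0 : 0 < ε) (h1 : ε < 1)
    {ψ : QuditSpace (n + 1) d} (hψ : ‖ψ‖ = 1)
    (h : ¬ IsFar ε (multipartiteProduct (n + 1) d) ψ) : (1 - ε ^ 2) ^ 2 ≤ firstPurity ψ := by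
  unfold IsFar at h
  push Not at h
  obtain ⟨φ, ⟨a, ha, hφa⟩, hlt⟩ := h
  have ha' (i : Fin (n + 1)) : ∑ k, ‖a i k‖ ^ 2 = 1 := by
    rw [← EuclideanSpace.norm_sq_eq, ha, one_pow]
  have hφ : ‖φ‖ = 1 := by
    rw [← sq_eq_sq₀ (norm_nonneg _) zero_le_one, EuclideanSpace.norm_sq_eq]
    simp only [hφa, sum_prod_normSq fun i k => a i k, ha', Finset.prod_const_one, one_pow]
  have h2 := (sqrt_one_sub_le_traceDist hφ hψ).trans_lt hlt
  rw [Real.sqrt_lt' h0] at h2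
  have h3 : ∑ x, star (φ x) * ψ x = ∑ k, ∑ y : Fin n → Fin d,
      star (a 0 k) * (∏ i : Fin n, star (a i.succ (y i))) *
        ψ (Fin.cons (α := fun _ => Fin d) k y) := by
    rw [← (Fin.consEquiv fun _ => Fin d).sum_comp, Fintype.sum_prod_type]
    refine Finset.sum_congr rfl fun k _ => Finset.sum_congr rfl fun y _ => ?_
    simp [hφa, Fin.consEquiv, Fin.prod_univ_succ]
  have h4 := norm_sum_mul_pow_four_le (fun k => star (a 0 k))
    (fun y : Fin n → Fin d => ∏ i, star (a i.succ (y i)))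
    (fun k y => ψ (Fin.cons (α := fun _ => Fin d) k y))
    (by simpa using ha' 0)
    (by simp only [sum_prod_normSq fun (i : Fin n) k => star (a i.succ k), norm_star, ha',
      Finset.prod_const_one])
  rw [← h3] at h4
  refine le_trans ?_ h4
  rw [show ‖∑ x, star (φ x) * ψ x‖ ^ 4 = (‖∑ x, star (φ x) * ψ x‖ ^ 2) ^ 2 by ring]
  exact pow_le_pow_left₀ (by nlinarith) (by linarith) 2

/-! ### Gaussian moments of the norm and of the purity -/

section Moments

open MeasureTheory MvPolynomial

variable {Ω σ : Type*} [MeasurableSpace Ω] [Fintype σ] {μ : Measure Ω} {g : Ω → σ → ℂ}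

theorem IsComplexGaussian.fischer_one_one (hg : IsComplexGaussian μ g) : fischer μ g 1 1 = 1 := by
  simpa using hg.fischer_monomial 0 0 1 1

theorem IsComplexGaussian.fischer_X_X [DecidableEq σ] (hg : IsComplexGaussian μ g) (a b : σ) :
    fischer μ g (X a) (X b) = if a = b then 1 else 0 := by
  rw [← mul_one (X a), hg.fischer_X_mul_left, pderiv_X]
  split_ifs with h
  · subst h
    rw [Pi.single_eq_same, hg.fischer_one_one]
  · rw [Pi.single_eq_of_ne (Ne.symm h)]
    simp [fischer]

theorem IsComplexGaussian.fischer_X_mul_X [DecidableEq σ] (hg : IsComplexGaussian μ g)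
    (a b c e : σ) : fischer μ g (X a * X b) (X c * X e) =
      (if a = c ∧ b = e then 1 else 0) + if a = e ∧ b = c then 1 else 0 := by
  have h (x y z : σ) : fischer μ g (X b) ((Pi.single x 1 : σ → MvPolynomial σ ℂ) y * X z) =
      if x = y ∧ b = z then 1 else 0 := by
    by_cases hxy : x = y
    · subst hxy
      simp [hg.fischer_X_X]
    · rw [Pi.single_eq_of_ne (Ne.symm hxy)]
      simp [fischer, hxy]
  rw [hg.fischer_X_mul_left, pderiv_mul, pderiv_X, pderiv_X, hg.fischer_add_right,
    mul_comm (X c), h, h]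

theorem IsComplexGaussian.integrable_sqNorm_pow (hg : IsComplexGaussian μ g) (T : ℕ) :
    Integrable (fun ω => (∑ i, ‖g ω i‖ ^ 2) ^ T) μ := by
  refine (hg.integral_sqNorm_pow_mul T (isHomogeneous_one σ ℂ)
    (isHomogeneous_one σ ℂ)).1.re.congr (.of_forall fun ω => ?_)
  simp only [map_one, star_one, mul_one, ← Complex.ofReal_pow, RCLike.re_to_complex,
    Complex.ofReal_re]

theorem IsComplexGaussian.integral_sqNorm_pow (hg : IsComplexGaussian μ g) (T : ℕ) :
    ∫ ω, (∑ i, ‖g ω i‖ ^ 2) ^ T ∂μ = ∏ j ∈ Finset.range T, ((Fintype.card σ : ℝ) + j) := by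
  have h := (hg.integral_sqNorm_pow_mul T (isHomogeneous_one σ ℂ) (isHomogeneous_one σ ℂ)).2
  simp only [map_one, star_one, mul_one, ← Complex.ofReal_pow, hg.fischer_one_one,
    integral_complex_ofReal, Nat.cast_zero, add_zero] at h
  exact_mod_cast h

theorem ofReal_firstPurity {n d : ℕ} (z : QuditIdx (n + 1) d → ℂ) :
    (firstPurity z : ℂ) = ∑ i : Fin d, ∑ j : Fin d, ∑ y : Fin n → Fin d, ∑ y' : Fin n → Fin d,
      star (eval z (X (Fin.cons (α := fun _ => Fin d) j y) *
        X (Fin.cons (α := fun _ => Fin d) i y'))) *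
      eval z (X (Fin.cons (α := fun _ => Fin d) i y) *
        X (Fin.cons (α := fun _ => Fin d) j y')) := by
  unfold firstPurity
  push_cast
  refine Finset.sum_congr rfl fun i _ => Finset.sum_congr rfl fun j _ => ?_
  rw [← Complex.mul_conj', map_sum, Finset.sum_mul_sum]
  refine Finset.sum_congr rfl fun y _ => Finset.sum_congr rfl fun y' _ => ?_
  simp only [eval_X, Complex.star_def, map_mul, Complex.conj_conj]
  ring

/-- For `T = 0` this is the mean purity `d m (d + m)` with `m = d ^ n`, out of `𝔼 ‖g‖⁴ = d m (d m + 1)`: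
a ratio of order `1 / d`. -/
theorem IsComplexGaussian.integral_firstPurity {n d : ℕ} {g : Ω → QuditIdx (n + 1) d → ℂ}
    (hg : IsComplexGaussian μ g) (T : ℕ) :
    Integrable (fun ω => (∑ x, ‖g ω x‖ ^ 2) ^ T * firstPurity (g ω)) μ ∧
      ∫ ω, (∑ x, ‖g ω x‖ ^ 2) ^ T * firstPurity (g ω) ∂μ =
        (∏ j ∈ Finset.range T, ((d : ℝ) ^ (n + 1) + 2 + j)) *
          ((d : ℝ) * d ^ n * (d + d ^ n)) := by
  have hX (a b : QuditIdx (n + 1) d) : (X a * X b : MvPolynomial _ ℂ).IsHomogeneous 2 :=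
    (isHomogeneous_X ℂ a).mul (isHomogeneous_X ℂ b)
  have h (t : Fin d × Fin d × (Fin n → Fin d) × (Fin n → Fin d)) :=
    hg.integral_sqNorm_pow_mul T
      (hX (Fin.cons (α := fun _ => Fin d) t.2.1 t.2.2.1)
        (Fin.cons (α := fun _ => Fin d) t.1 t.2.2.2))
      (hX (Fin.cons (α := fun _ => Fin d) t.1 t.2.2.1)
        (Fin.cons (α := fun _ => Fin d) t.2.1 t.2.2.2))
  have key (ω : Ω) : (((∑ x, ‖g ω x‖ ^ 2) ^ T * firstPurity (g ω) : ℝ) : ℂ) =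
      ∑ t : Fin d × Fin d × (Fin n → Fin d) × (Fin n → Fin d),
        ((∑ x, ‖g ω x‖ ^ 2 : ℝ) : ℂ) ^ T *
        (star (eval (g ω) (X (Fin.cons (α := fun _ => Fin d) t.2.1 t.2.2.1) *
          X (Fin.cons (α := fun _ => Fin d) t.1 t.2.2.2))) *
        eval (g ω) (X (Fin.cons (α := fun _ => Fin d) t.1 t.2.2.1) *
          X (Fin.cons (α := fun _ => Fin d) t.2.1 t.2.2.2))) := by
    rw [Complex.ofReal_mul, ofReal_firstPurity, Complex.ofReal_pow, ← Finset.mul_sum]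
    simp only [Fintype.sum_prod_type]
  constructor
  · refine (integrable_finsetSum Finset.univ fun t _ => (h t).1).re.congr (.of_forall fun ω => ?_)
    simp only [← key, RCLike.re_to_complex, Complex.ofReal_re]
  · refine Complex.ofReal_injective ?_
    rw [← integral_complex_ofReal]
    simp only [key]
    rw [integral_finsetSum _ fun t _ => (h t).1]
    simp only [(h _).2]
    rw [← Finset.mul_sum, Complex.ofReal_mul]
    refine congrArg₂ (· * ·) ?_ ?_
    · simp
    · have hsymm (a b : Fin d) : (a = b ∧ b = a) ↔ a = b := ⟨And.left, fun h => ⟨h, h.symm⟩⟩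
      have hsymm' (a b : Fin n → Fin d) : (a = b ∧ b = a) ↔ a = b :=
        ⟨And.left, fun h => ⟨h, h.symm⟩⟩
      simp only [hg.fischer_X_mul_X, Fin.cons_inj, eq_self, and_true, true_and, hsymm, hsymm',
        Fintype.sum_prod_type,
        Finset.sum_add_distrib]
      simp [apply_ite Finset.card]
      ring

end Moments

/-! ### The maximally mixed state against the two ensembles -/

/-- The vector `0` is included, so that no case distinction is needed for `T = 0`, where `0` copies of
the zero vector have trace `1`. -/
theorem exists_unit_smul {ι : Type} [Fintype ι] [DecidableEq ι] [Nonempty ι]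
    (z : EuclideanSpace ℂ ι) : ∃ u : EuclideanSpace ℂ ι, ‖u‖ = 1 ∧ z = (‖z‖ : ℂ) • u := by
  by_cases hz : z = 0
  · exact ⟨EuclideanSpace.single (Classical.arbitrary ι) 1, by simp, by simp [hz]⟩
  · have hz' : (‖z‖ : ℂ) ≠ 0 := by simpa using hz
    exact ⟨(‖z‖ : ℂ)⁻¹ • z, by simp [norm_smul, hz], by rw [smul_smul, mul_inv_cancel₀ hz', one_smul]⟩

theorem copies_smul {ι : Type} (T : ℕ) (c : ℂ) (ψ : EuclideanSpace ℂ ι) :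
    copies T (c • ψ) = (((‖c‖ ^ 2) ^ T : ℝ) : ℂ) • copies T ψ := by
  ext x y
  simp only [copies, tensorOp, ketBra, Matrix.of_apply, Matrix.smul_apply, PiLp.smul_apply,
    smul_eq_mul]
  push_cast
  rw [← Complex.mul_conj', ← Fin.prod_const, ← Finset.prod_mul_distrib]
  refine Finset.prod_congr rfl fun t _ => ?_
  simp only [star_mul', Complex.star_def]
  ring

theorem re_trace_mul_copies_smul {ι : Type} [Fintype ι] {T : ℕ}
    (N : Matrix (Fin T → ι) (Fin T → ι) ℂ) (c : ℂ) (ψ : EuclideanSpace ℂ ι) :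
    ((N * copies T (c • ψ)).trace).re = (‖c‖ ^ 2) ^ T * ((N * copies T ψ).trace).re := by
  rw [copies_smul, Matrix.mul_smul, Matrix.trace_smul, smul_eq_mul, Complex.re_ofReal_mul]

theorem re_trace_one_sub_mul_copies {ι : Type} [Fintype ι] [DecidableEq ι] {T : ℕ}
    (M : Matrix (Fin T → ι) (Fin T → ι) ℂ) {ψ : EuclideanSpace ℂ ι} (hψ : ‖ψ‖ = 1) :
    (((1 - M) * copies T ψ).trace).re = 1 - ((M * copies T ψ).trace).re := by
  have h : (copies T ψ).trace = 1 := by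
    rw [copies, trace_tensorOp, trace_ketBra, hψ]
    simp
  rw [sub_mul, one_mul, Matrix.trace_sub, h, Complex.sub_re, Complex.one_re]

theorem re_trace_mul_copies_nonneg {ι : Type} [Fintype ι] [DecidableEq ι] {T : ℕ}
    {N : Matrix (Fin T → ι) (Fin T → ι) ℂ} (hN : N.PosSemidef) (ψ : EuclideanSpace ℂ ι) :
    0 ≤ ((N * copies T ψ).trace).re := by
  obtain ⟨B, rfl⟩ := hN.exists_eq_conjTranspose_mul_self
  have h : copies T ψ = ketBra (WithLp.toLp 2 fun x : Fin T → ι => ∏ t, ψ (x t)) := by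
    ext x y
    simp [copies, tensorOp, ketBra, Finset.prod_mul_distrib]
  rw [h, trace_conjTranspose_mul_self_mul_ketBra, Complex.ofReal_re]
  positivity

theorem firstPurity_smul {n d : ℕ} (c : ℂ) (z : QuditIdx (n + 1) d → ℂ) :
    firstPurity (fun x => c * z x) = (‖c‖ ^ 2) ^ 2 * firstPurity z := by
  simp only [firstPurity, Finset.mul_sum]
  refine Finset.sum_congr rfl fun i _ => Finset.sum_congr rfl fun j _ => ?_
  have h : ‖c‖ ^ 2 = ‖c * star c‖ := by rw [norm_mul, norm_star, sq]
  rw [h, ← mul_pow, ← norm_mul, Finset.mul_sum]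
  congr 3 with y
  simp only [star_mul']
  ring

theorem prod_range_add_two (x : ℝ) (T : ℕ) : ∏ j ∈ Finset.range (T + 2), (x + j) =
    x * (x + 1) * ∏ j ∈ Finset.range T, (x + 2 + j) := by
  rw [Finset.prod_range_succ', Finset.prod_range_succ', mul_assoc, mul_comm]
  refine congrArg₂ (· * ·) ?_ (Finset.prod_congr rfl fun j _ => ?_)
  · push_cast
    ring
  · push_cast
    ring

open MeasureTheory MvPolynomial in
/-- On product states the tester rejects with probability at most `1/3`; hence so it does, up to the
ratio of the Gaussian moments, on the maximally mixed state. -/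
theorem re_trace_one_sub_le {n d T : ℕ} [NeZero d] {ε : ℝ}
    {M : Matrix (Fin T → QuditIdx n d) (Fin T → QuditIdx n d) ℂ}
    (hM : IsAdaptiveSingleCopy M) (hT : IsTester ε (multipartiteProduct n d) M) :
    ((1 - M).trace).re ≤ 1 / 3 * (∏ j ∈ Finset.range T, ((d : ℝ) + j)) ^ n := by
  have hg₁ := isComplexGaussian_polarGaussian (Fin d)
  have hg := hg₁.pi (A := Fin n)
  set g : (Fin n → Fin d → ℝ × UnitAddCircle) → Fin n × Fin d → ℂ :=
    fun ω i => polarGaussian (ω i.1 i.2)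
  let P : QuditIdx n d → MvPolynomial (Fin n × Fin d) ℂ := fun x => ∏ i, X (i, x i)
  have h := (hg.trace_le_integral (P := P)
    (hg.multilinear_mul_le (fun i k => (i, k)) (fun _ _ h => h)) 1 hM).2
  have hint := hg.integrable_trace_mul_copies P 1 (1 - M)
  simp only [map_one, norm_one, one_pow, one_mul, integral_const, probReal_univ, smul_eq_mul,
    mul_one] at h hint
  refine h.trans ?_
  have hpt (ω : Fin n → Fin d → ℝ × UnitAddCircle) :
      (((1 - M) * copies T (polyState P (g ω))).trace).re ≤
        1 / 3 * ∏ i, (∑ k, ‖polarGaussian (ω i k)‖ ^ 2) ^ T := by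
    choose u hu hzu using fun i : Fin n =>
      exists_unit_smul (WithLp.toLp 2 fun k => polarGaussian (ω i k) : EuclideanSpace ℂ (Fin d))
    let ψ : QuditSpace n d := WithLp.toLp 2 fun x => ∏ i, u i (x i)
    have hψ : ‖ψ‖ = 1 := by
      rw [← sq_eq_sq₀ (norm_nonneg _) zero_le_one, EuclideanSpace.norm_sq_eq]
      simp only [ψ, sum_prod_normSq fun i k => u i k, ← EuclideanSpace.norm_sq_eq, hu, one_pow,
        Finset.prod_const_one]
    have hPψ : polyState P (g ω) = (∏ i, (‖(WithLp.toLp 2 fun k => polarGaussian (ω i k) :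
        EuclideanSpace ℂ (Fin d))‖ : ℂ)) • ψ := by
      ext x
      simp only [polyState, P, eval_prod, eval_X, g, PiLp.smul_apply, smul_eq_mul, ψ,
        ← Finset.prod_mul_distrib]
      refine Finset.prod_congr rfl fun i _ => ?_
      simpa using congrArg (fun v : EuclideanSpace ℂ (Fin d) => v (x i)) (hzu i)
    have h1 : (((1 - M) * copies T ψ).trace).re ≤ 1 / 3 := by
      rw [re_trace_one_sub_mul_copies M hψ]
      have := hT.completeness ψ hψ ⟨u, hu, fun x => rfl⟩
      linarith
    rw [hPψ, re_trace_mul_copies_smul, mul_comm]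
    refine (mul_le_mul_of_nonneg_right h1 (by positivity)).trans_eq ?_
    congr 1
    simp only [norm_prod, Complex.norm_real, norm_norm, ← Finset.prod_pow,
      EuclideanSpace.norm_sq_eq]
  refine (integral_mono hint ((Integrable.fintype_prod
    (μ := fun _ : Fin n => Measure.pi fun _ : Fin d => polarMeasure)
    fun _ => hg₁.integrable_sqNorm_pow T).const_mul _) hpt).trans_eq ?_
  rw [integral_const_mul, integral_fintype_prod_eq_prod
    (μ := fun _ : Fin n => Measure.pi fun _ : Fin d => polarMeasure)
    (fun _ (z : Fin d → ℝ × UnitAddCircle) => (∑ k, ‖polarGaussian (z k)‖ ^ 2) ^ T)]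
  simp [hg₁.integral_sqNorm_pow]

open MeasureTheory MvPolynomial in
/-- A random Gaussian state `g` is typically far from product, so that the tester accepts it with
probability not much more than `1/3`; hence so it does on the maximally mixed state. The probability
of not being far is bounded by the mean purity (Markov's inequality); weighting by `‖g‖⁴` clears the
denominator of the normalized purity. -/
theorem re_trace_le {n d T : ℕ} [NeZero d] {ε : ℝ} (h0 : 0 < ε) (h1 : ε < 1)
    {M : Matrix (Fin T → QuditIdx (n + 1) d) (Fin T → QuditIdx (n + 1) d) ℂ}
    (hM : IsAdaptiveSingleCopy M) (hT : IsTester ε (multipartiteProduct (n + 1) d) M) :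
    (M.trace).re * ((d : ℝ) ^ (n + 1) * (d ^ (n + 1) + 1)) ≤
      (∏ j ∈ Finset.range T, ((d : ℝ) ^ (n + 1) + 2 + j)) *
        (1 / 3 * ((d : ℝ) ^ (n + 1) * (d ^ (n + 1) + 1)) +
          (d : ℝ) * d ^ n * (d + d ^ n) / (1 - ε ^ 2) ^ 2) := by
  have hε : 0 < 1 - ε ^ 2 := by nlinarith
  have hg := isComplexGaussian_polarGaussian (QuditIdx (n + 1) d)
  set μ := Measure.pi fun _ : QuditIdx (n + 1) d => polarMeasure
  set g : (QuditIdx (n + 1) d → ℝ × UnitAddCircle) → QuditIdx (n + 1) d → ℂ :=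
    fun ω x => polarGaussian (ω x)
  have hX (v : QuditIdx (n + 1) d → ℂ) (q : MvPolynomial (QuditIdx (n + 1) d) ℂ) :
      (∑ x, ‖v x‖ ^ 2) * ∫ ω, ‖eval (g ω) q‖ ^ 2 ∂μ ≤
        ∫ ω, ‖eval (g ω) ((∑ x, C (v x) * X x) * q)‖ ^ 2 ∂μ := by
    have := hg.sum_integral_normSq_le id Function.injective_id (fun x => C (v x))
      (fun _ _ => pderiv_C) q
    simp only [eval_mul, eval_C, norm_mul, mul_pow, integral_const_mul, ← Finset.sum_mul, id] at this
    simpa only [mul_comm (C _), eval_mul, norm_mul, mul_pow] using this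
  have h2 (x y : QuditIdx (n + 1) d) := (hg.trace_le_integral hX (X x * X y) hM).1
  have hint (x y : QuditIdx (n + 1) d) := hg.integrable_trace_mul_copies X (X x * X y) M
  have hsq (ω : QuditIdx (n + 1) d → ℝ × UnitAddCircle) : ∑ x, ∑ y,
      ‖eval (g ω) (X x * X y)‖ ^ 2 = (∑ x, ‖g ω x‖ ^ 2) ^ 2 := by
    simp only [eval_mul, eval_X, norm_mul, mul_pow]
    rw [sq (∑ x, _), Finset.sum_mul_sum]
  have hint1 : Integrable (fun ω => (∑ x, ‖g ω x‖ ^ 2) ^ 2 *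
      ((M * copies T (polyState X (g ω))).trace).re) μ := by
    refine (integrable_finsetSum Finset.univ fun x _ =>
      integrable_finsetSum Finset.univ fun y _ => hint x y).congr (.of_forall fun ω => ?_)
    simp only [← Finset.sum_mul, hsq]
  -- The weight `‖g‖⁴` is the sum of the weights `|g x * g y|²`.
  have hmain : (M.trace).re * ∫ ω, (∑ x, ‖g ω x‖ ^ 2) ^ 2 ∂μ ≤
      ∫ ω, (∑ x, ‖g ω x‖ ^ 2) ^ 2 * ((M * copies T (polyState X (g ω))).trace).re ∂μ := by
    have := Finset.sum_le_sum fun x (_ : x ∈ Finset.univ) =>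
      Finset.sum_le_sum fun y (_ : y ∈ Finset.univ) => h2 x y
    simp only [← Finset.mul_sum] at this
    simp_rw [← integral_finsetSum Finset.univ fun y _ => hint _ y,
      ← integral_finsetSum Finset.univ fun y _ => hg.integrable_normSq (X _ * X y)] at this
    rw [← integral_finsetSum Finset.univ fun x _ =>
      integrable_finsetSum Finset.univ fun y _ => hint x y,
      ← integral_finsetSum Finset.univ fun x _ =>
      integrable_finsetSum Finset.univ fun y _ => hg.integrable_normSq (X x * X y)] at this
    simpa only [← Finset.sum_mul, hsq] using this
  have hpt (ω : QuditIdx (n + 1) d → ℝ × UnitAddCircle) :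
      (∑ x, ‖g ω x‖ ^ 2) ^ 2 * ((M * copies T (polyState X (g ω))).trace).re ≤
        1 / 3 * (∑ x, ‖g ω x‖ ^ 2) ^ (T + 2) +
          ((1 - ε ^ 2) ^ 2)⁻¹ * ((∑ x, ‖g ω x‖ ^ 2) ^ T * firstPurity (g ω)) := by
    obtain ⟨u, hu, hzu⟩ := exists_unit_smul (polyState X (g ω))
    have hS : ∑ x, ‖g ω x‖ ^ 2 = ‖(‖polyState X (g ω)‖ : ℂ)‖ ^ 2 := by
      rw [Complex.norm_real, norm_norm, EuclideanSpace.norm_sq_eq]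
      simp [polyState]
    have hQ : firstPurity (g ω) = (∑ x, ‖g ω x‖ ^ 2) ^ 2 * firstPurity u := by
      rw [hS, ← firstPurity_smul]
      congr 1
      ext x
      simpa [polyState] using congrArg (fun v : QuditSpace (n + 1) d => v x) hzu
    rw [hzu, re_trace_mul_copies_smul, ← hS, hQ]
    set S := ∑ x, ‖g ω x‖ ^ 2
    have hS0 : 0 ≤ S := by positivity
    have hQ0 : 0 ≤ firstPurity u := by unfold firstPurity; positivity
    have h3 : ((M * copies T u).trace).re ≤ 1 / 3 + ((1 - ε ^ 2) ^ 2)⁻¹ * firstPurity u := by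
      by_cases hfar : IsFar ε (multipartiteProduct (n + 1) d) u
      · have := hT.soundness u hu hfar
        have : 0 ≤ ((1 - ε ^ 2) ^ 2)⁻¹ * firstPurity u := by positivity
        linarith
      · have h4 := le_firstPurity_of_not_isFar h0 h1 hu hfar
        have h5 := re_trace_mul_copies_nonneg hT.posSemidef_compl u
        rw [re_trace_one_sub_mul_copies M hu] at h5
        have h6 : 1 ≤ ((1 - ε ^ 2) ^ 2)⁻¹ * firstPurity u := by
          rw [inv_mul_eq_div, one_le_div (by positivity)]
          exact h4
        linarith
    calc S ^ 2 * (S ^ T * ((M * copies T u).trace).re)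
        ≤ S ^ 2 * (S ^ T * (1 / 3 + ((1 - ε ^ 2) ^ 2)⁻¹ * firstPurity u)) := by gcongr
      _ = _ := by ring
  have hP := hg.integral_firstPurity T
  have hint2 := (hg.integrable_sqNorm_pow (T + 2)).const_mul (1 / 3)
  have hint3 := hP.1.const_mul ((1 - ε ^ 2) ^ 2)⁻¹
  have hfin : _ ≤ ∫ ω, (1 / 3 * (∑ x, ‖g ω x‖ ^ 2) ^ (T + 2) +
      ((1 - ε ^ 2) ^ 2)⁻¹ * ((∑ x, ‖g ω x‖ ^ 2) ^ T * firstPurity (g ω))) ∂μ :=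
    hmain.trans (integral_mono hint1 (hint2.add hint3) hpt)
  rw [integral_add hint2 hint3,
    integral_const_mul, integral_const_mul, hP.2, hg.integral_sqNorm_pow,
    hg.integral_sqNorm_pow, prod_range_add_two, prod_range_add_two _ T] at hfin
  simp only [Finset.prod_range_zero, Fintype.card_pi, Fintype.card_fin, Finset.prod_const,
    Finset.card_univ, Nat.cast_pow, mul_one] at hfin
  refine hfin.trans_eq ?_
  ring

/-! ### The lower bound -/

theorem prod_range_add_le {x : ℝ} (hx : 0 < x) (c T : ℕ) :
    ∏ j ∈ Finset.range T, (x + c + j) ≤ x ^ T * Real.exp (T * (T + c) / x) := by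
  have h : ∀ j ∈ Finset.range T, x + c + j ≤ x * Real.exp ((T + c) / x) := fun j hj => by
    have hj : (j : ℝ) ≤ T := by exact_mod_cast (Finset.mem_range.1 hj).le
    have h1 := Real.add_one_le_exp ((T + c) / x)
    calc x + c + j ≤ x * ((T + c) / x + 1) := by
          rw [mul_add, mul_div_cancel₀ _ hx.ne']
          linarith
      _ ≤ _ := by gcongr
  refine (Finset.prod_le_prod (fun j _ => by positivity) h).trans_eq ?_
  rw [Finset.prod_const, Finset.card_range, mul_pow, ← Real.exp_nat_mul, mul_div_assoc]

theorem exp_le_of_le_sixteenth {x : ℝ} (hx : x ≤ 1 / 16) : Real.exp x ≤ 16 / 15 := by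
  refine (Real.exp_le_exp.2 hx).trans ?_
  have h := Real.one_sub_le_exp_neg (1 / 16)
  rw [Real.exp_neg] at h
  have := le_inv_of_le_inv₀ (by norm_num) h
  norm_num at this ⊢
  linarith

theorem exp_le_of_le_three_sixteenths {x : ℝ} (hx : x ≤ 3 / 16) : Real.exp x ≤ 16 / 13 := by
  refine (Real.exp_le_exp.2 hx).trans ?_
  have h := Real.one_sub_le_exp_neg (3 / 16)
  rw [Real.exp_neg] at h
  have := le_inv_of_le_inv₀ (by norm_num) h
  norm_num at this ⊢
  linarith

theorem theorem5 :
    ∃ c : ℝ, 0 < c ∧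
      ∀ ε : ℝ, 0 < ε → ε < 1 →
        ∃ d₀ : ℕ, ∀ d : ℕ, d₀ ≤ d → ∀ n : ℕ, 2 ≤ n → ∀ T : ℕ,
          ∀ M : Matrix (Fin T → QuditIdx n d) (Fin T → QuditIdx n d) ℂ,
            IsAdaptiveSingleCopy M → IsTester ε (multipartiteProduct n d) M →
              c * √((d : ℝ) / (n : ℝ)) ≤ (T : ℝ) := by
  refine ⟨1 / 4, by norm_num, fun ε h0 h1 => ?_⟩
  have hε : 0 < 1 - ε ^ 2 := by nlinarith
  -- Then `2 / (d * (1 - ε ^ 2) ^ 2) ≤ 1 / 12`, which bounds the contribution of the Gaussian states that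
  -- are not far from product.
  refine ⟨⌈24 / (1 - ε ^ 2) ^ 2⌉₊ + 1, fun d hd n hn T M hM hT => ?_⟩
  by_contra! hlt
  obtain ⟨k, rfl⟩ : ∃ k, n = k + 1 := ⟨n - 1, by omega⟩
  have hd1 : 1 ≤ d := by omega
  have : NeZero d := ⟨by omega⟩
  have hdpos : (0 : ℝ) < d := by exact_mod_cast hd1
  have hd24 : 24 / (1 - ε ^ 2) ^ 2 ≤ d :=
    (Nat.le_ceil _).trans (by exact_mod_cast (Nat.le_succ _).trans hd)
  have hnT : ((k + 1 : ℕ) : ℝ) * ((T : ℝ) * T) / d ≤ 1 / 16 := by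
    have hn0 : (0 : ℝ) < ((k + 1 : ℕ) : ℝ) := by positivity
    have h2 := mul_self_le_mul_self (Nat.cast_nonneg T) hlt.le
    rw [mul_mul_mul_comm, Real.mul_self_sqrt (by positivity)] at h2
    rw [div_le_iff₀ hdpos]
    calc ((k + 1 : ℕ) : ℝ) * ((T : ℝ) * T)
        ≤ ((k + 1 : ℕ) : ℝ) * (1 / 4 * (1 / 4) * ((d : ℝ) / ((k + 1 : ℕ) : ℝ))) := by gcongr
      _ = 1 / 16 * d := by field_simp; norm_num
  set D : ℝ := (d : ℝ) ^ (k + 1) with hDdef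
  have hm : (d : ℝ) ≤ d ^ k := le_self_pow₀ (by exact_mod_cast hd1) (by omega)
  have hDm : D = d * d ^ k := by rw [hDdef, pow_succ, mul_comm]
  set m : ℝ := (d : ℝ) ^ k
  have hDpos : 0 < D := by positivity
  have hdD : (d : ℝ) ≤ D := by
    rw [hDm]
    exact le_mul_of_one_le_right hdpos.le (one_le_pow₀ (by exact_mod_cast hd1))
  have htr : (M.trace).re + ((1 - M).trace).re = D ^ T := by
    rw [Matrix.trace_sub, Complex.sub_re, Matrix.trace_one]
    have h2 : ((Fintype.card (Fin T → QuditIdx (k + 1) d) : ℂ)).re = _ := Complex.natCast_re _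
    rw [h2]
    simp [D]
  -- `exp (n T² / d) ≤ 16 / 15`, because `n T² / d ≤ 1 / 16`
  have hrej : ((1 - M).trace).re ≤ 1 / 3 * (D ^ T * (16 / 15)) := by
    refine (re_trace_one_sub_le hM hT).trans ?_
    have h2 := prod_range_add_le hdpos 0 T
    simp only [Nat.cast_zero, add_zero] at h2
    have h3 : (∏ j ∈ Finset.range T, ((d : ℝ) + j)) ^ (k + 1) ≤ D ^ T * (16 / 15) := by
      refine (pow_le_pow_left₀ (by positivity) h2 (k + 1)).trans ?_
      rw [mul_pow, ← pow_mul, mul_comm T, pow_mul, ← Real.exp_nat_mul, ← mul_div_assoc]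
      exact mul_le_mul_of_nonneg_left (exp_le_of_le_sixteenth hnT) (by positivity)
    linarith
  -- `exp (T (T + 2) / D) ≤ 16 / 13`, because `T (T + 2) / D ≤ 3 T² / d ≤ 3 / 16`
  have hacc : (M.trace).re ≤ D ^ T * (16 / 13) * (5 / 12) := by
    have h2 := re_trace_le h0 h1 hM hT
    have h3 : ∏ j ∈ Finset.range T, (D + 2 + j) ≤ D ^ T * (16 / 13) := by
      have h4 := prod_range_add_le hDpos 2 T
      refine (by simpa using h4 : _ ≤ D ^ T * Real.exp (T * (T + 2) / D)).trans ?_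
      refine mul_le_mul_of_nonneg_left (exp_le_of_le_three_sixteenths ?_) (by positivity)
      have hTT : (T : ℝ) * (T + 2) ≤ 3 * (T * T) := by
        have : (T : ℝ) ≤ T * T := by exact_mod_cast Nat.le_mul_self T
        linarith
      have h5 : (T : ℝ) * T ≤ 1 / 16 * d := by
        rw [div_le_iff₀ hdpos] at hnT
        refine le_trans ?_ hnT
        exact le_mul_of_one_le_left (by positivity) (by exact_mod_cast Nat.succ_pos k)
      rw [div_le_iff₀ hDpos]
      linarith
    have h6 : (d : ℝ) * m * (d + m) / (1 - ε ^ 2) ^ 2 ≤ 1 / 12 * (D * (D + 1)) := by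
      have h7 : 1 / (1 - ε ^ 2) ^ 2 ≤ d / 24 := by
        rw [le_div_iff₀ (by norm_num), div_mul_eq_mul_div, one_mul]
        exact hd24
      rw [← hDm, mul_div_assoc, mul_comm (1 / 12), mul_assoc]
      refine mul_le_mul_of_nonneg_left ?_ hDpos.le
      calc (d + m) / (1 - ε ^ 2) ^ 2 = (d + m) * (1 / (1 - ε ^ 2) ^ 2) := by ring
        _ ≤ (m + m) * (d / 24) := by gcongr
        _ = D * (1 / 12) := by rw [hDm]; ring
        _ ≤ (D + 1) * (1 / 12) := by linarith
    have h8 : (M.trace).re * (D * (D + 1)) ≤ (D ^ T * (16 / 13) * (5 / 12)) * (D * (D + 1)) := by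
      refine h2.trans ?_
      calc _ ≤ D ^ T * (16 / 13) * (1 / 3 * (D * (D + 1)) + 1 / 12 * (D * (D + 1))) := by gcongr
        _ = _ := by ring
    exact le_of_mul_le_mul_right h8 (by positivity)
  -- The two bounds sum to less than the total `D ^ T`, as `16 / 45 + 20 / 39 < 1`.
  have hDT : 0 < D ^ T := by positivity
  linarith
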